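/- Let $d\ge 1$ and let $h=(h_1,\dots,h_d)\in\Delta$, i.e. $0<h_1\le\dots\le h_d\le 1$. Let $\mathcal P_h$ be the $d$-dimensional space of exponential polynomials spanned by the functions $t^{m_i}e^{-h_i t}$, $i=1,\dots,d$, where $m_i$ is the number of indices $j<i$ with $h_j=h_i$ (so $m_i=0$ for all $i$ if the exponents are distinct). Write $\|f\|=\sup_{t\ge 0}|f(t)|$, let $M_2(h)=\max\{\|p''\| : p\in\mathcal P_h,\ \|p\|\le 1\}$, and for $\varepsilon>0$ let $\kappa(h,\varepsilon)$ be the value of the problem $$\frac{1-p(0)}{p'(0)-\varepsilon p(0)}\to\min,\qquad p\in\mathcal P_h,\ \|p\|\le 1,\ p'(0)>\varepsilon p(0).$$ Then for every $\varepsilon>0$ the minimum $\kappa(h,\varepsilon)$ is attained, and the following holds. (1) Let $d\ge 2$. There are a unique $T\in\mathcal P_h$ (the $h$-Chebyshev polynomial) and unique points $0=\nu_1<\nu_2<\dots<\nu_d$ such that $\|T\|=1$ and $T(\nu_k)=(-1)^k$ for $k=1,\dots,d$. The univariate problem $$\frac{1-T(t)}{T'(t)-\varepsilon T(t)}\to\min,\qquad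 t\in[0,\nu_2],\ T'(t)>\varepsilon T(t),$$ attains its minimum, and its value is equal to $\kappa(h,\varepsilon)$. (2) $\displaystyle \kappa(h,\varepsilon)>\frac{2\varepsilon}{M_2(h)+2\varepsilon^2}$. -/

import Mathlib

noncomputable section

/-- The simplex of exponent vectors: `0 < h₁ ≤ h₂ ≤ ⋯ ≤ h_d ≤ 1`. -/
def expSimplex (d : ℕ) : Set (Fin d → ℝ) :=
  {h | (∀ i, 0 < h i) ∧ Monotone h ∧ ∀ i, h i ≤ 1}

/-- The `i`-th function `t ^ m * exp (- h i * t)` of the exponential system, where `m` is the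
number of earlier indices carrying the same exponent (so `m = 0` when the exponents are distinct,
and an exponent of multiplicity `n` receives the powers `1, t, …, t ^ (n - 1)`). -/
def expFun {d : ℕ} (h : Fin d → ℝ) (i : Fin d) (t : ℝ) : ℝ :=
  t ^ (Finset.univ.filter fun j : Fin d => j < i ∧ h j = h i).card * Real.exp (-(h i) * t)

/-- The space of exponential polynomials with exponents `h`. -/
def expPoly {d : ℕ} (h : Fin d → ℝ) : Submodule ℝ (ℝ → ℝ) :=
  Submodule.span ℝ (Set.range (expFun h))

/-- The sup norm on the half-line `[0, ∞)`. It is only applied to functions that are bounded there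
(exponential polynomials with positive exponents and their derivatives). -/
def halfLineNorm (f : ℝ → ℝ) : ℝ :=
  sSup ((fun t => |f t|) '' Set.Ici (0 : ℝ))

/-- The Markov-Bernstein constant: the largest `‖p^(k)‖` over the unit ball of `expPoly h`. -/
def markovConst {d : ℕ} (k : ℕ) (h : Fin d → ℝ) : ℝ :=
  sSup {v : ℝ | ∃ p ∈ expPoly h, halfLineNorm p ≤ 1 ∧ v = halfLineNorm (iteratedDeriv k p)}

/-- `T` is the Chebyshev polynomial of `expPoly h`, with points of alternance
`0 = ν 0 < ν 1 < ⋯ < ν (d - 1)`, indexed from `0`; the values there are `-1, 1, -1, …`. -/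
structure IsExpChebyshev {d : ℕ} (h : Fin d → ℝ) (T : ℝ → ℝ) (ν : Fin d → ℝ) : Prop where
  mem : T ∈ expPoly h
  norm_eq : halfLineNorm T = 1
  strictMono : StrictMono ν
  first : ∀ i : Fin d, (i : ℕ) = 0 → ν i = 0
  alternance : ∀ i : Fin d, T (ν i) = (-1) ^ ((i : ℕ) + 1)

/-- The values of the objective `(1 - p 0) / (p' 0 - ε * p 0)` at the feasible points `p` of the
`d`-dimensional problem. -/
def kappaValues {d : ℕ} (h : Fin d → ℝ) (ε : ℝ) : Set ℝ :=
  {v | ∃ p ∈ expPoly h, halfLineNorm p ≤ 1 ∧ ε * p 0 < deriv p 0 ∧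
    v = (1 - p 0) / (deriv p 0 - ε * p 0)}

/-- The value `κ(h, ε)` of the `d`-dimensional minimization problem. -/
def kappa {d : ℕ} (h : Fin d → ℝ) (ε : ℝ) : ℝ :=
  sInf (kappaValues h ε)

/-- The values of the objective `(1 - T t) / (T' t - ε * T t)` at the feasible points
`t ∈ [0, b]` of the univariate problem. -/
def univariateValues (T : ℝ → ℝ) (b ε : ℝ) : Set ℝ :=
  {v | ∃ t ∈ Set.Icc 0 b, ε * T t < deriv T t ∧ v = (1 - T t) / (deriv T t - ε * T t)}

end

/-! The space is the kernel of a product of real first-order operators `D + h i`, so it is closed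
under differentiation and translation. Rolle's theorem applied to `exp (c * t) * f t` gives a
nonzero member at most `d - 1` zeros; variants count weak sign alternations and a double zero
(`eq_zero_of_alternation` and its neighbours). Members decay at infinity, and finite dimension
supplies the compactness that makes `kappa` attained.

Let `p` be a minimizer and `d = k + 2`. It has `k + 1` alternance points in `(0, ∞)`, the first with
value `1`. Otherwise the half-line splits into `k + 1` pieces on which `p` avoids `1, -1, 1, …` in
turn. Some `q` vanishes at the left ends of the pieces, has the matching signs and `q' 0 > 0`; for
small `δ > 0`, `p + δ q` is feasible with the same value and a larger derivative at `0`, hence a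
smaller objective.

Continued to the left, `p` is injective up to its first alternance point and cannot stay bounded on
the whole line, so it reaches `-1` at some `-τ`. The translate of `p` by `-τ` is a Chebyshev
polynomial, so existence of `T` comes from the minimizer itself, with `kappa` as the univariate
value at `τ`. Conversely, translates of `T` are feasible. Counting alternations of `T - S` gives
uniqueness.

For the lower bound, a strict Taylor estimate yields `p' 0 ^ 2 < 2 * M * (1 - p 0)` when `p' 0 > 0`;
completing a square finishes. -/

open Set Filter Topology

/-! ### Counting zeros and sign alternations in kernels of differential operators. -/

section

/-- The kernel of the differential operator `∏_{i < n} (D + a i)`. -/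
def expKer (a : ℕ → ℝ) : ℕ → Submodule ℝ (ℝ → ℝ)
  | 0 => ⊥
  | n + 1 =>
    { carrier := {f | Differentiable ℝ f ∧ (fun t => deriv f t + a n * f t) ∈ expKer a n}
      add_mem' := by
        rintro f g ⟨hf, hf'⟩ ⟨hg, hg'⟩
        refine ⟨hf.add hg, ?_⟩
        convert (expKer a n).add_mem hf' hg' using 1
        funext t
        simp only [Pi.add_apply, deriv_add (hf t) (hg t)]
        ring
      zero_mem' := by
        refine ⟨differentiable_const 0, ?_⟩
        convert (expKer a n).zero_mem using 1
        funext t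
        simp
      smul_mem' := by
        rintro c f ⟨hf, hf'⟩
        refine ⟨hf.const_smul c, ?_⟩
        convert (expKer a n).smul_mem c hf' using 1
        funext t
        simp only [Pi.smul_apply, smul_eq_mul, deriv_const_smul c (hf t)]
        ring }

variable {a : ℕ → ℝ} {n : ℕ} {f : ℝ → ℝ}

theorem mem_expKer_zero : f ∈ expKer a 0 ↔ f = 0 := Submodule.mem_bot ℝ

theorem mem_expKer_succ : f ∈ expKer a (n + 1) ↔
    Differentiable ℝ f ∧ (fun t => deriv f t + a n * f t) ∈ expKer a n := Iff.rfl

theorem differentiable_of_mem_expKer (hf : f ∈ expKer a n) : Differentiable ℝ f := by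
  cases n with
  | zero => rw [mem_expKer_zero.1 hf]; exact differentiable_const 0
  | succ n => exact hf.1

theorem deriv_mem_expKer (hf : f ∈ expKer a n) : deriv f ∈ expKer a n := by
  induction n generalizing f with
  | zero =>
    rw [mem_expKer_zero] at hf ⊢
    subst hf
    funext t
    simp
  | succ n ih =>
    have hg := ih hf.2
    have hgd := differentiable_of_mem_expKer hf.2
    have e : deriv f = fun t => (deriv f t + a n * f t) - a n * f t := by
      funext t; ring
    have hd : Differentiable ℝ (deriv f) := by
      rw [e]; exact hgd.sub (hf.1.const_mul _)
    refine ⟨hd, ?_⟩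
    convert hg using 1
    funext t
    rw [deriv_fun_add (hd t) ((hf.1 t).const_mul _), deriv_const_mul _ (hf.1 t)]

theorem comp_add_mem_expKer (hf : f ∈ expKer a n) (s : ℝ) :
    (fun t => f (t + s)) ∈ expKer a n := by
  induction n generalizing f with
  | zero =>
    rw [mem_expKer_zero] at hf ⊢
    subst hf
    rfl
  | succ n ih =>
    refine ⟨hf.1.comp (differentiable_id.add_const s), ?_⟩
    convert ih hf.2 using 1
    funext t
    rw [deriv_comp_add_const]

/-- The integrating factor that transfers Rolle and mean value arguments from `D` to `D + c`. -/
theorem hasDerivAt_exp_mul (hf : Differentiable ℝ f) (c t : ℝ) :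
    HasDerivAt (fun t => Real.exp (c * t) * f t) (Real.exp (c * t) * (deriv f t + c * f t)) t := by
  have h1 : HasDerivAt (fun t => Real.exp (c * t)) (Real.exp (c * t) * c) t := by
    simpa using ((hasDerivAt_id t).const_mul c).exp
  exact (h1.fun_mul (hf t).hasDerivAt).congr_deriv (by ring)

/-- If `f' + c f = 0` and `f` is nonnegative somewhere and nonpositive somewhere, then `f = 0`. -/
theorem eq_zero_of_deriv_add_mul_eq_zero (hf : Differentiable ℝ f) {c x y : ℝ}
    (h : ∀ t, deriv f t + c * f t = 0) (hx : 0 ≤ f x) (hy : f y ≤ 0) : f = 0 := by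
  have hconst := is_const_of_deriv_eq_zero
    (fun t => (hasDerivAt_exp_mul hf c t).differentiableAt)
    (fun t => by rw [(hasDerivAt_exp_mul hf c t).deriv, h, mul_zero])
  funext t
  have h1 := hconst t x
  have h2 := hconst t y
  have p1 := Real.exp_pos (c * t)
  have p2 := Real.exp_pos (c * x)
  have p3 := Real.exp_pos (c * y)
  have h3 : 0 ≤ Real.exp (c * t) * f t := h1 ▸ mul_nonneg p2.le hx
  have h4 : Real.exp (c * t) * f t ≤ 0 := h2 ▸ mul_nonpos_of_nonneg_of_nonpos p3.le hy
  have h5 := le_antisymm h4 h3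
  simpa [p1.ne'] using h5

/-- Rolle's theorem for finite sets of zeros. -/
theorem exists_finset_deriv_eq_zero {F F' : ℝ → ℝ} (hF : ∀ t, HasDerivAt F (F' t) t)
    (Z : Finset ℝ) (hZ : ∀ z ∈ Z, F z = 0) :
    ∃ W : Finset ℝ, Z.card ≤ W.card + 1 ∧ Disjoint W Z ∧ (∀ w ∈ W, F' w = 0) ∧
      ∀ w ∈ W, ∃ z ∈ Z, w < z := by
  induction Z using Finset.induction_on_max with
  | empty => exact ⟨∅, by simp⟩
  | insert m Z hm ih =>
    obtain ⟨W, hc, hd, hW, hlt⟩ := ih fun z hz => hZ z (Finset.mem_insert_of_mem hz)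
    have hmZ : m ∉ Z := fun h => (hm m h).false
    rcases Z.eq_empty_or_nonempty with rfl | hne
    · exact ⟨∅, by simp⟩
    set b := Z.max' hne
    have hb : b ∈ Z := Z.max'_mem hne
    obtain ⟨ξ, hξ, hξ'⟩ := exists_hasDerivAt_eq_zero (hm b hb)
      (fun t _ => (hF t).continuousAt.continuousWithinAt)
      (by rw [hZ b (Finset.mem_insert_of_mem hb), hZ m (Finset.mem_insert_self _ _)])
      (fun t _ => hF t)
    -- The clause that each old point lies below some element of `Z` keeps `W` to the left of `b`,
    -- so `ξ` is new.
    have hξW : ξ ∉ W := fun h => by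
      obtain ⟨z, hz, hz'⟩ := hlt ξ h
      exact (hz'.trans_le (Z.le_max' z hz)).not_gt hξ.1
    have hξZ : ξ ∉ Z := fun h => (Z.le_max' ξ h).not_gt hξ.1
    refine ⟨insert ξ W, ?_, ?_, ?_, ?_⟩
    · rw [Finset.card_insert_of_notMem hξW, Finset.card_insert_of_notMem hmZ]
      omega
    · rw [Finset.disjoint_insert_left, Finset.disjoint_insert_right, Finset.mem_insert]
      refine ⟨fun h => h.elim (fun h => hξ.2.ne h) hξZ, fun h => ?_, hd⟩
      obtain ⟨z, hz, hz'⟩ := hlt m h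
      exact (hz'.trans (hm z hz)).false
    · intro w hw
      rcases Finset.mem_insert.1 hw with rfl | hw
      exacts [hξ', hW w hw]
    · intro w hw
      rcases Finset.mem_insert.1 hw with rfl | hw
      · exact ⟨m, Finset.mem_insert_self _ _, hξ.2⟩
      · obtain ⟨z, hz, hz'⟩ := hlt w hw
        exact ⟨z, Finset.mem_insert_of_mem hz, hz'⟩

theorem exists_finset_deriv_add_mul_eq_zero (hf : Differentiable ℝ f) (c : ℝ)
    (Z : Finset ℝ) (hZ : ∀ z ∈ Z, f z = 0) :
    ∃ W : Finset ℝ, Z.card ≤ W.card + 1 ∧ Disjoint W Z ∧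
      ∀ w ∈ W, deriv f w + c * f w = 0 := by
  obtain ⟨W, h1, h2, h3, -⟩ := exists_finset_deriv_eq_zero (fun t => hasDerivAt_exp_mul hf c t) Z
    (fun z hz => by simp [hZ z hz])
  refine ⟨W, h1, h2, fun w hw => ?_⟩
  simpa [(Real.exp_pos _).ne'] using h3 w hw

/-- A function in `expKer a n` with `n` zeros vanishes identically. -/
theorem eq_zero_of_card_zeros (hf : f ∈ expKer a n) (Z : Finset ℝ) (hZ : ∀ z ∈ Z, f z = 0)
    (hc : n ≤ Z.card) : f = 0 := by
  induction n generalizing f Z with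
  | zero => exact mem_expKer_zero.1 hf
  | succ n ih =>
    obtain ⟨W, hW, -, hW'⟩ := exists_finset_deriv_add_mul_eq_zero hf.1 (a n) Z hZ
    have h0 := ih hf.2 W hW' (by omega)
    obtain ⟨z, hz⟩ : Z.Nonempty := Finset.card_pos.1 (by omega)
    exact eq_zero_of_deriv_add_mul_eq_zero hf.1 (fun t => congrFun h0 t) (hZ z hz).ge (hZ z hz).le

/-- A function in `expKer a n` with `n - 1` zeros, one of them double, vanishes identically. -/
theorem eq_zero_of_double_zero (hf : f ∈ expKer a n) (Z : Finset ℝ) (hZ : ∀ z ∈ Z, f z = 0)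
    (hc : n ≤ Z.card + 1) {z : ℝ} (hz : z ∈ Z) (hz' : deriv f z = 0) : f = 0 := by
  cases n with
  | zero => exact mem_expKer_zero.1 hf
  | succ n =>
    obtain ⟨W, hW, hd, hW'⟩ := exists_finset_deriv_add_mul_eq_zero hf.1 (a n) Z hZ
    -- The double zero is also a zero of `f' + a n * f`, and it is distinct from the Rolle points;
    -- it makes up the missing zero.
    have hzW : z ∉ W := Finset.disjoint_right.1 hd hz
    have h0 := eq_zero_of_card_zeros hf.2 (insert z W)
      (fun w hw => by
        rcases Finset.mem_insert.1 hw with rfl | hw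
        · simp [hz', hZ w hz]
        · exact hW' w hw)
      (by rw [Finset.card_insert_of_notMem hzW]; omega)
    exact eq_zero_of_deriv_add_mul_eq_zero hf.1 (fun t => congrFun h0 t) (hZ z hz).ge (hZ z hz).le

/-- Between two points of weak sign alternation of `f` there is a point where `f' + c f` has the
sign of the second one. -/
theorem exists_sign_deriv_add_mul (hf : Differentiable ℝ f) (c : ℝ) {x y σ : ℝ} (hxy : x < y)
    (hx : 0 ≤ σ * f x) (hy : 0 ≤ -σ * f y) :
    ∃ ξ ∈ Ioo x y, 0 ≤ -σ * (deriv f ξ + c * f ξ) := by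
  obtain ⟨ξ, hξ, h⟩ := exists_hasDerivAt_eq_slope _ _ hxy
    (fun t _ => (hasDerivAt_exp_mul hf c t).continuousAt.continuousWithinAt)
    (fun t _ => hasDerivAt_exp_mul hf c t)
  refine ⟨ξ, hξ, ?_⟩
  rw [eq_div_iff (sub_pos.2 hxy).ne'] at h
  have p1 := Real.exp_pos (c * ξ)
  have h2 : Real.exp (c * ξ) * (y - x) * (-σ * (deriv f ξ + c * f ξ)) =
      Real.exp (c * y) * (-σ * f y) + Real.exp (c * x) * (σ * f x) := by
    linear_combination (-σ) * h
  have h3 : 0 ≤ Real.exp (c * ξ) * (y - x) * (-σ * (deriv f ξ + c * f ξ)) := by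
    rw [h2]; positivity
  exact nonneg_of_mul_nonneg_right h3 (mul_pos p1 (sub_pos.2 hxy))

/-- Weak sign alternations of `f` give weak sign alternations of `f' + c f` in between. -/
theorem exists_alternation_deriv_add_mul (hf : Differentiable ℝ f) (c : ℝ) {t : ℕ → ℝ} {σ : ℝ}
    (ht : ∀ i < n, t i < t (i + 1)) (hs : ∀ i ≤ n, 0 ≤ σ * (-1) ^ i * f (t i)) :
    ∃ u : ℕ → ℝ, ∀ i < n, u i ∈ Ioo (t i) (t (i + 1)) ∧
      0 ≤ (-σ) * (-1) ^ i * (deriv f (u i) + c * f (u i)) := by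
  have key : ∀ i, ∃ u, i < n → u ∈ Ioo (t i) (t (i + 1)) ∧
      0 ≤ (-σ) * (-1) ^ i * (deriv f u + c * f u) := by
    intro i
    by_cases hi : i < n
    · obtain ⟨u, hu, h⟩ := exists_sign_deriv_add_mul hf c (ht i hi) (hs i hi.le)
        (by have := hs (i + 1) hi; rw [pow_succ] at this; linarith)
      exact ⟨u, fun _ => ⟨hu, by linarith⟩⟩
    · exact ⟨0, fun h => absurd h hi⟩
  choose u hu using key
  exact ⟨u, hu⟩

/-- A function in `expKer a n` with `n` weak sign alternations vanishes identically. -/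
theorem eq_zero_of_alternation (hf : f ∈ expKer a n) {t : ℕ → ℝ} {σ : ℝ} (hσ : σ ≠ 0)
    (ht : ∀ i < n, t i < t (i + 1)) (hs : ∀ i ≤ n, 0 ≤ σ * (-1) ^ i * f (t i)) : f = 0 := by
  induction n generalizing f t σ with
  | zero => exact mem_expKer_zero.1 hf
  | succ n ih =>
    obtain ⟨u, hu⟩ := exists_alternation_deriv_add_mul hf.1 (a n) ht hs
    have h0 := ih hf.2 (t := u) (neg_ne_zero.2 hσ)
      (fun i hi => (hu i (by omega)).1.2.trans (hu (i + 1) (by omega)).1.1)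
      (fun i hi => (hu i (by omega)).2)
    have h1 := hs 0 (by omega)
    have h2 := hs 1 (by omega)
    have h3 : ∀ t, deriv f t + a n * f t = 0 := fun t => congrFun h0 t
    rcases hσ.lt_or_gt with h | h
    · exact eq_zero_of_deriv_add_mul_eq_zero hf.1 h3 (x := t 1) (y := t 0)
        (by norm_num at h2; nlinarith) (by norm_num at h1; nlinarith)
    · exact eq_zero_of_deriv_add_mul_eq_zero hf.1 h3 (x := t 0) (y := t 1)
        (by norm_num at h1; nlinarith) (by norm_num at h2; nlinarith)

/-- A function in `expKer a (n + 1)` with `n` weak sign alternations, the last of them at a double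
zero, vanishes identically. -/
theorem eq_zero_of_alternation_of_double_zero (hf : f ∈ expKer a (n + 1)) {t : ℕ → ℝ} {σ : ℝ}
    (hσ : σ ≠ 0) (ht : ∀ i < n, t i < t (i + 1)) (hs : ∀ i ≤ n, 0 ≤ σ * (-1) ^ i * f (t i))
    (h0 : f (t n) = 0) (h1 : deriv f (t n) = 0) : f = 0 := by
  obtain ⟨u, hu⟩ := exists_alternation_deriv_add_mul hf.1 (a n) ht hs
  -- The double zero survives as a zero of `f' + a n * f`, where any sign is allowed, so it serves
  -- as the last alternation point.
  have h2 := eq_zero_of_alternation hf.2 (t := fun i => if i < n then u i else t n)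
    (neg_ne_zero.2 hσ)
    (fun i hi => by
      by_cases h : i + 1 < n
      · simp only [hi, h, if_true]
        exact (hu i hi).1.2.trans (hu (i + 1) h).1.1
      · have : i + 1 = n := by omega
        simp only [hi, h, if_true, if_false]
        exact this ▸ (hu i hi).1.2)
    (fun i hi => by
      by_cases h : i < n
      · simp only [h, if_true]
        exact (hu i h).2
      · simp [h, h0, h1])
  exact eq_zero_of_deriv_add_mul_eq_zero hf.1 (fun t => congrFun h2 t) h0.ge h0.le

end

/-! ### Exponential polynomials as the kernel of a differential operator. -/

section

variable {a : ℕ → ℝ} {n : ℕ} {f : ℝ → ℝ}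

open Polynomial in
theorem degree_derivative_lt_iff (P : ℝ[X]) (n : ℕ) :
    (derivative P).degree < n ↔ P.degree < (n + 1 : ℕ) := by
  simp only [degree_lt_iff_coeff_zero, coeff_derivative]
  constructor
  · intro h m hm
    obtain ⟨k, rfl⟩ := Nat.exists_eq_add_of_le' (show 1 ≤ m by omega)
    simpa [Nat.cast_add_one_ne_zero] using h k (by omega)
  · intro h m hm
    simp [h (m + 1) (by omega)]

open Polynomial in
theorem degree_derivative_add_C_mul (P : ℝ[X]) {c : ℝ} (hc : c ≠ 0) :
    (derivative P + C c * P).degree = P.degree := by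
  rcases eq_or_ne P 0 with rfl | hP
  · simp
  have h : (C c * P).degree = P.degree := degree_C_mul hc
  rw [degree_add_eq_right_of_degree_lt (h ▸ degree_derivative_lt hP), h]

open Polynomial in
/-- `P(t) e^{-bt}` lies in `expKer a n` iff `deg P` is less than the multiplicity of `b` among
`a 0, …, a (n - 1)`. -/
theorem polynomial_mul_exp_mem_expKer_iff (P : ℝ[X]) (b : ℝ) :
    (fun t => P.eval t * Real.exp (-b * t)) ∈ expKer a n ↔
      P.degree < (Nat.count (fun k => a k = b) n : ℕ) := by
  induction n generalizing P with
  | zero =>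
    rw [mem_expKer_zero, Nat.count_zero, degree_lt_iff_coeff_zero]
    constructor
    · intro h
      have : P = 0 := Polynomial.funext fun t => by
        simpa [(Real.exp_pos _).ne'] using congrFun h t
      simp [this]
    · intro h
      have : P = 0 := Polynomial.ext fun m => by simpa using h m (Nat.zero_le _)
      funext t
      simp [this]
  | succ n ih =>
    have hd : ∀ t, HasDerivAt (fun t => P.eval t * Real.exp (-b * t))
        (((derivative P) + C (-b) * P).eval t * Real.exp (-b * t)) t := by
      intro t
      have h1 : HasDerivAt (fun t => Real.exp (-b * t)) (Real.exp (-b * t) * -b) t := by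
        simpa using ((hasDerivAt_id t).const_mul (-b)).exp
      refine ((P.hasDerivAt t).fun_mul h1).congr_deriv ?_
      simp only [eval_add, eval_mul, eval_C]
      ring
    have he : (fun t => deriv (fun t => P.eval t * Real.exp (-b * t)) t +
        a n * (P.eval t * Real.exp (-b * t))) =
        fun t => (derivative P + C (a n - b) * P).eval t * Real.exp (-b * t) := by
      funext t
      rw [(hd t).deriv]
      simp only [eval_add, eval_mul, eval_C]
      ring
    have hdiff : Differentiable ℝ fun t => P.eval t * Real.exp (-b * t) :=
      fun t => (hd t).differentiableAt
    rw [mem_expKer_succ, he, ih, Nat.count_succ, and_iff_right hdiff]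
    -- A factor `D + b` lowers the degree of `P` by one; any other factor preserves it. Hence only
    -- occurrences of `b` count.
    by_cases hb : a n = b
    · simp only [hb, sub_self, C_0, zero_mul, add_zero, if_true, degree_derivative_lt_iff]
    · simp only [hb, if_false, add_zero, degree_derivative_add_C_mul P (sub_ne_zero.2 hb)]

/-- A vector of exponents, continued to an infinite sequence. -/
noncomputable def expSeq {d : ℕ} (h : Fin d → ℝ) (k : ℕ) : ℝ := if hk : k < d then h ⟨k, hk⟩ else 0

variable {d : ℕ} {h : Fin d → ℝ}

theorem card_filter_eq_count (h : Fin d → ℝ) (i : Fin d) :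
    (Finset.univ.filter fun j : Fin d => j < i ∧ h j = h i).card =
      Nat.count (fun k => expSeq h k = h i) i := by
  rw [Nat.count_eq_card_filter_range]
  refine Finset.card_bij (fun j _ => (j : ℕ)) ?_ (fun _ _ _ _ => Fin.ext) ?_
  · intro j hj
    simp only [Finset.mem_filter, Finset.mem_univ, true_and] at hj
    rw [Finset.mem_filter, Finset.mem_range]
    exact ⟨hj.1, by simp [expSeq, hj.2]⟩
  · intro k hk
    simp only [Finset.mem_filter, Finset.mem_range] at hk
    have hkd : k < d := hk.1.trans i.2
    refine ⟨⟨k, hkd⟩, ?_, rfl⟩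
    simp only [Finset.mem_filter, Finset.mem_univ, true_and]
    exact ⟨hk.1, by simpa [expSeq, hkd] using hk.2⟩

/-- The power of `t` is the number of earlier occurrences of `h i`, so the degree condition holds
exactly once index `i` itself has been counted. -/
theorem expFun_mem_expKer_iff (i : Fin d) : expFun h i ∈ expKer (expSeq h) n ↔ (i : ℕ) < n := by
  have e : expFun h i = fun t => (Polynomial.X ^ Nat.count (fun k => expSeq h k = h i) i :
      Polynomial ℝ).eval t * Real.exp (-(h i) * t) := by
    funext t
    simp [expFun, card_filter_eq_count]
  rw [e, polynomial_mul_exp_mem_expKer_iff, Polynomial.degree_X_pow, Nat.cast_lt]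
  refine ⟨fun hlt => ?_, fun hin => Nat.count_strict_mono (by simp [expSeq]) hin⟩
  by_contra hn
  exact (Nat.count_monotone _ (not_lt.1 hn)).not_gt hlt

/-- Triangularity: the last function in a nontrivial relation would lie in the kernel of order `i`,
which contains the earlier functions but not the `i`-th. -/
theorem linearIndependent_expFun (h : Fin d → ℝ) : LinearIndependent ℝ (expFun h) := by
  rw [Fintype.linearIndependent_iff]
  intro g hg
  by_contra! hne
  have hS : (Finset.univ.filter fun i => g i ≠ 0).Nonempty := by
    obtain ⟨i, hi⟩ := hne
    exact ⟨i, by simpa using hi⟩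
  set i := (Finset.univ.filter fun i => g i ≠ 0).max' hS
  have hi : g i ≠ 0 := by
    simpa using Finset.max'_mem _ hS
  have hgt : ∀ j, i < j → g j = 0 := by
    intro j hj
    by_contra hgj
    exact (Finset.le_max' (Finset.univ.filter fun i => g i ≠ 0) j (by simpa using hgj)).not_gt hj
  have hmem : g i • expFun h i ∈ expKer (expSeq h) i := by
    rw [← Finset.add_sum_erase _ _ (Finset.mem_univ i)] at hg
    rw [eq_neg_of_add_eq_zero_left hg]
    refine Submodule.neg_mem _ (Submodule.sum_mem _ fun j hj => ?_)
    rcases lt_or_gt_of_ne (Finset.ne_of_mem_erase hj) with hlt | hlt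
    · exact Submodule.smul_mem _ _ ((expFun_mem_expKer_iff j).2 hlt)
    · simp [hgt j hlt]
  exact lt_irrefl _ ((expFun_mem_expKer_iff i).1 ((Submodule.smul_mem_iff _ hi).1 hmem))

/-- Evaluation at the points `0, 1, …, n - 1`. -/
def evalNat (n : ℕ) : (ℝ → ℝ) →ₗ[ℝ] (Fin n → ℝ) where
  toFun f i := f (i : ℕ)
  map_add' _ _ := rfl
  map_smul' _ _ := rfl

theorem eq_zero_of_evalNat_eq_zero (hf : f ∈ expKer a n) (h0 : evalNat n f = 0) : f = 0 := by
  refine eq_zero_of_card_zeros hf (Finset.univ.image fun i : Fin n => ((i : ℕ) : ℝ)) ?_ ?_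
  · intro z hz
    obtain ⟨i, -, rfl⟩ := Finset.mem_image.1 hz
    exact congrFun h0 i
  · rw [Finset.card_image_of_injective _ fun i j hij => Fin.ext (Nat.cast_injective hij)]
    simp

/-- Dimension count: `d` independent functions lie in a kernel whose evaluation at `d` nodes is
injective. This makes every zero count available for `expPoly h`. -/
theorem expPoly_eq_expKer (h : Fin d → ℝ) : expPoly h = expKer (expSeq h) d := by
  have hle : expPoly h ≤ expKer (expSeq h) d := by
    rw [expPoly, Submodule.span_le]
    rintro _ ⟨i, rfl⟩
    exact (expFun_mem_expKer_iff i).2 i.2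
  have hinj : Function.Injective ((evalNat d).comp (expKer (expSeq h) d).subtype) := by
    rw [← LinearMap.ker_eq_bot, LinearMap.ker_eq_bot']
    exact fun m hm => Subtype.ext (eq_zero_of_evalNat_eq_zero m.2 hm)
  have : FiniteDimensional ℝ (expKer (expSeq h) d) := FiniteDimensional.of_injective _ hinj
  refine Submodule.eq_of_le_of_finrank_le hle ?_
  rw [expPoly, finrank_span_eq_card (linearIndependent_expFun h)]
  simpa using LinearMap.finrank_le_finrank_of_injective hinj

/-! ### Decay, coefficient bounds and attainment of the minimum. -/

/-- The exponential polynomial with given coefficients. -/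
noncomputable def expSum (h : Fin d → ℝ) (c : Fin d → ℝ) (t : ℝ) : ℝ := ∑ i, c i * expFun h i t

theorem mem_expPoly_iff : f ∈ expPoly h ↔ ∃ c, f = expSum h c := by
  rw [expPoly, Submodule.mem_span_range_iff_exists_fun]
  refine exists_congr fun c => ?_
  rw [eq_comm]
  refine Eq.congr_right ?_
  funext t
  simp [expSum]

theorem expSum_mem (h : Fin d → ℝ) (c : Fin d → ℝ) : expSum h c ∈ expPoly h :=
  mem_expPoly_iff.2 ⟨c, rfl⟩

theorem differentiable_of_mem_expPoly (hf : f ∈ expPoly h) : Differentiable ℝ f :=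
  differentiable_of_mem_expKer (expPoly_eq_expKer h ▸ hf)

theorem deriv_mem_expPoly (hf : f ∈ expPoly h) : deriv f ∈ expPoly h := by
  rw [expPoly_eq_expKer] at *
  exact deriv_mem_expKer hf

theorem comp_add_mem_expPoly (hf : f ∈ expPoly h) (s : ℝ) : (fun t => f (t + s)) ∈ expPoly h := by
  rw [expPoly_eq_expKer] at *
  exact comp_add_mem_expKer hf s

theorem expFun_mem (h : Fin d → ℝ) (i : Fin d) : expFun h i ∈ expPoly h :=
  Submodule.subset_span ⟨i, rfl⟩

theorem tendsto_expFun (h : Fin d → ℝ) (i : Fin d) (hi : 0 < h i) :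
    Tendsto (expFun h i) atTop (𝓝 0) := by
  change Tendsto (fun t => expFun h i t) atTop (𝓝 0)
  simpa [expFun, Real.rpow_natCast] using tendsto_rpow_mul_exp_neg_mul_atTop_nhds_zero
    ((Finset.univ.filter fun j : Fin d => j < i ∧ h j = h i).card : ℝ) (h i) hi

theorem tendsto_zero_of_mem_expPoly (hpos : ∀ i, 0 < h i) (hf : f ∈ expPoly h) :
    Tendsto f atTop (𝓝 0) := by
  obtain ⟨c, rfl⟩ := mem_expPoly_iff.1 hf
  have := tendsto_finsetSum Finset.univ fun i _ => (tendsto_expFun h i (hpos i)).const_mul (c i)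
  simpa [expSum] using! this

theorem bddAbove_halfLine {f : ℝ → ℝ} (hf : Continuous f) (h0 : Tendsto f atTop (𝓝 0)) :
    BddAbove ((fun t => |f t|) '' Ici (0 : ℝ)) := by
  obtain ⟨R, hR⟩ := eventually_atTop.1 (h0.abs.eventually (gt_mem_nhds (by simp : |(0 : ℝ)| < 1)))
  obtain ⟨B, hB⟩ := (isCompact_Icc (a := (0 : ℝ)) (b := R)).bddAbove_image hf.abs.continuousOn
  refine ⟨max B 1, ?_⟩
  rintro _ ⟨t, ht, rfl⟩
  rcases le_total t R with h | h
  · exact (hB ⟨t, ⟨ht, h⟩, rfl⟩).trans (le_max_left _ _)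
  · exact (hR t h).le.trans (le_max_right _ _)

theorem bddAbove_of_mem_expPoly (hpos : ∀ i, 0 < h i) (hf : f ∈ expPoly h) :
    BddAbove ((fun t => |f t|) '' Ici (0 : ℝ)) :=
  bddAbove_halfLine (differentiable_of_mem_expPoly hf).continuous (tendsto_zero_of_mem_expPoly hpos hf)

theorem abs_le_halfLineNorm (hpos : ∀ i, 0 < h i) (hf : f ∈ expPoly h) {t : ℝ} (ht : 0 ≤ t) :
    |f t| ≤ halfLineNorm f :=
  le_csSup (bddAbove_of_mem_expPoly hpos hf) ⟨t, ht, rfl⟩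

theorem halfLineNorm_le {f : ℝ → ℝ} {M : ℝ} (hM : ∀ t, 0 ≤ t → |f t| ≤ M) :
    halfLineNorm f ≤ M :=
  csSup_le ⟨_, 0, self_mem_Ici, rfl⟩ (by rintro _ ⟨t, ht, rfl⟩; exact hM t ht)

theorem halfLineNorm_le_iff (hpos : ∀ i, 0 < h i) (hf : f ∈ expPoly h) {M : ℝ} :
    halfLineNorm f ≤ M ↔ ∀ t, 0 ≤ t → |f t| ≤ M :=
  ⟨fun hM _ ht => (abs_le_halfLineNorm hpos hf ht).trans hM, halfLineNorm_le⟩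

/-- The coefficients of an exponential polynomial are controlled by its values on `[0, ∞)`. -/
theorem exists_coeff_bound (h : Fin d → ℝ) : ∃ K : ℝ, 0 ≤ K ∧ ∀ (c : Fin d → ℝ) (M : ℝ), 0 ≤ M →
    (∀ t, 0 ≤ t → |expSum h c t| ≤ M) → ∀ i, |c i| ≤ K * M := by
  -- The values at `0, …, d - 1` suffice: they depend on the coefficients through an injective
  -- linear map in finite dimension, which is bounded below.
  set G := (evalNat d).comp (Fintype.linearCombination ℝ (expFun h)) with hG
  have hsum : ∀ c, Fintype.linearCombination ℝ (expFun h) c = expSum h c := by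
    intro c
    funext t
    simp [Fintype.linearCombination_apply, expSum]
  have hker : LinearMap.ker G = ⊥ := by
    rw [LinearMap.ker_eq_bot']
    intro c hc
    have h0 : expSum h c = 0 := by
      refine eq_zero_of_evalNat_eq_zero (expPoly_eq_expKer h ▸ expSum_mem h c) ?_
      rw [← hsum]
      exact hc
    rw [← hsum, Fintype.linearCombination_apply] at h0
    exact funext (Fintype.linearIndependent_iff.1 (linearIndependent_expFun h) c h0)
  obtain ⟨K, -, hK⟩ := G.exists_antilipschitzWith hker
  refine ⟨K, K.2, fun c M hM hc i => ?_⟩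
  have h1 : ‖c‖ ≤ K * ‖G c‖ := by
    simpa using hK.le_mul_dist c 0
  have h2 : ‖G c‖ ≤ M := by
    refine (pi_norm_le_iff_of_nonneg hM).2 fun j => ?_
    have : G c j = expSum h c (j : ℕ) := by
      rw [← hsum]; rfl
    rw [this]
    exact hc _ (Nat.cast_nonneg _)
  exact (norm_le_pi_norm c i).trans (h1.trans (mul_le_mul_of_nonneg_left h2 K.2))

theorem deriv_expSum (h : Fin d → ℝ) (c : Fin d → ℝ) :
    deriv (expSum h c) = fun t => ∑ i, c i * deriv (expFun h i) t := by
  funext t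
  have hd : ∀ i, Differentiable ℝ (expFun h i) := fun i =>
    differentiable_of_mem_expPoly (expFun_mem h i)
  refine HasDerivAt.deriv ?_
  unfold expSum
  exact HasDerivAt.fun_sum fun i _ => ((hd i t).hasDerivAt).const_mul (c i)

theorem deriv_deriv_expSum (h : Fin d → ℝ) (c : Fin d → ℝ) :
    deriv (deriv (expSum h c)) = fun t => ∑ i, c i * deriv (deriv (expFun h i)) t := by
  funext t
  have hd : ∀ i, Differentiable ℝ (deriv (expFun h i)) := fun i =>
    differentiable_of_mem_expPoly (deriv_mem_expPoly (expFun_mem h i))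
  rw [deriv_expSum]
  exact (HasDerivAt.fun_sum fun i _ => ((hd i t).hasDerivAt).const_mul (c i)).deriv

theorem abs_sum_mul_le {ι : Type*} [Fintype ι] {c g : ι → ℝ} {K : ℝ} (hc : ∀ i, |c i| ≤ K) :
    |∑ i, c i * g i| ≤ K * ∑ i, |g i| := by
  rw [Finset.mul_sum]
  refine (Finset.abs_sum_le_sum_abs _ _).trans (Finset.sum_le_sum fun i _ => ?_)
  rw [abs_mul]
  exact mul_le_mul_of_nonneg_right (hc i) (abs_nonneg _)

/-- The unit ball of `expPoly h` decays uniformly at infinity. -/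
theorem exists_uniform_decay (hpos : ∀ i, 0 < h i) : ∃ φ : ℝ → ℝ, Tendsto φ atTop (𝓝 0) ∧
    ∀ p ∈ expPoly h, (∀ t, 0 ≤ t → |p t| ≤ 1) → ∀ t, |p t| ≤ φ t := by
  obtain ⟨K, -, hK⟩ := exists_coeff_bound h
  refine ⟨fun t => K * 1 * ∑ i, |expFun h i t|, ?_, ?_⟩
  · have := (tendsto_finsetSum Finset.univ fun i _ => (tendsto_expFun h i (hpos i)).abs).const_mul
      (K * 1)
    simpa using this
  · intro p hp h1 t
    obtain ⟨c, rfl⟩ := mem_expPoly_iff.1 hp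
    exact abs_sum_mul_le (hK c 1 zero_le_one h1)

/-- An exponential polynomial with positive exponents that is bounded on the line vanishes. -/
theorem eq_zero_of_bounded (hpos : ∀ i, 0 < h i) (hf : f ∈ expPoly h) (hb : ∀ t, |f t| ≤ 1) :
    f = 0 := by
  obtain ⟨φ, hφ, hle⟩ := exists_uniform_decay hpos
  funext t
  -- A translate of `f` takes the value `f t` at `s` and is again in the unit ball; then `s` tends
  -- to infinity.
  have h1 : ∀ s, |f t| ≤ φ s := by
    intro s
    have := hle _ (comp_add_mem_expPoly hf (t - s)) (fun _ _ => hb _) s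
    simpa using this
  have h2 := ge_of_tendsto' hφ h1
  simpa using h2

theorem iteratedDeriv_two (f : ℝ → ℝ) : iteratedDeriv 2 f = deriv (deriv f) := by
  rw [iteratedDeriv_succ, iteratedDeriv_one]

/-- Translation moves any `t ≥ 0` to the origin without leaving the unit ball, so coefficient bounds
control `p''` everywhere. Boundedness makes the supremum in `markovConst` genuine. -/
theorem bddAbove_markov (hpos : ∀ i, 0 < h i) : BddAbove
    {v : ℝ | ∃ p ∈ expPoly h, halfLineNorm p ≤ 1 ∧ v = halfLineNorm (iteratedDeriv 2 p)} := by
  obtain ⟨K, -, hK⟩ := exists_coeff_bound h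
  refine ⟨K * 1 * ∑ i, |deriv (deriv (expFun h i)) 0|, ?_⟩
  rintro _ ⟨p, hp, h1, rfl⟩
  rw [halfLineNorm_le_iff hpos hp] at h1
  refine halfLineNorm_le fun t ht => ?_
  obtain ⟨c, hc⟩ := mem_expPoly_iff.1 (comp_add_mem_expPoly hp t)
  have h2 : ∀ s, 0 ≤ s → |expSum h c s| ≤ 1 := by
    intro s hs
    rw [← hc]
    exact h1 _ (by positivity)
  have h3 : iteratedDeriv 2 p t = deriv (deriv (expSum h c)) 0 := by
    rw [← hc, iteratedDeriv_two]
    have : deriv (fun s => p (s + t)) = fun s => deriv p (s + t) := by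
      funext s
      rw [deriv_comp_add_const]
    rw [this, deriv_comp_add_const, zero_add]
  rw [h3, deriv_deriv_expSum]
  exact abs_sum_mul_le (hK c 1 zero_le_one h2)

/-- If `p 0 = 1`, the right difference quotients at `0` are nonpositive. -/
theorem value_lt_one {p : ℝ → ℝ} (hp : Differentiable ℝ p) (h1 : ∀ t, 0 ≤ t → |p t| ≤ 1)
    (hlt : 0 < deriv p 0) : p 0 < 1 := by
  refine (abs_le.1 (h1 0 le_rfl)).2.lt_of_ne fun h0 => hlt.not_ge ?_
  have h7 := (hp 0).hasDerivAt
  rw [hasDerivAt_iff_tendsto_slope_zero] at h7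
  refine le_of_tendsto (h7.mono_left (nhdsGT_le_nhdsNE 0)) ?_
  filter_upwards [self_mem_nhdsWithin] with t ht
  have h9 : p (0 + t) ≤ 1 := by
    rw [zero_add]
    exact (abs_le.1 (h1 t (le_of_lt ht))).2
  rw [h0, smul_eq_mul]
  exact mul_nonpos_of_nonneg_of_nonpos (inv_nonneg.2 (le_of_lt ht)) (by linarith)

/-- The infimum defining `kappa` is attained. -/
theorem isLeast_kappa (hd : 1 ≤ d) (hpos : ∀ i, 0 < h i) {ε : ℝ} (hε : 0 < ε) :
    IsLeast (kappaValues h ε) (kappa h ε) := by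
  suffices H : ∃ v, IsLeast (kappaValues h ε) v by
    obtain ⟨v, hv⟩ := H
    rw [kappa, hv.csInf_eq]
    exact hv
  obtain ⟨K, hK0, hK⟩ := exists_coeff_bound h
  set N : (Fin d → ℝ) → ℝ := fun c => 1 - expSum h c 0 with hN
  set D : (Fin d → ℝ) → ℝ := fun c => deriv (expSum h c) 0 - ε * expSum h c 0 with hD
  have hcont : ∀ t, Continuous fun c => expSum h c t := by
    intro t
    unfold expSum
    fun_prop
  have hNc : Continuous N := continuous_const.sub (hcont 0)
  have hDc : Continuous D := by
    refine Continuous.sub ?_ (continuous_const.mul (hcont 0))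
    simp only [deriv_expSum]
    fun_prop
  -- the negative of the first exponential is feasible
  obtain ⟨c₀, hc₀⟩ : ∃ c₀ : Fin d → ℝ, (fun t => -Real.exp (-h ⟨0, hd⟩ * t)) = expSum h c₀ := by
    refine mem_expPoly_iff.1 ?_
    convert Submodule.neg_mem _ (expFun_mem h ⟨0, hd⟩) using 1
    funext t
    have : (Finset.univ.filter fun j : Fin d => j < ⟨0, hd⟩ ∧ h j = h ⟨0, hd⟩) = ∅ := by
      ext j
      simp [Fin.lt_def]
    simp [expFun, this]
  have hball₀ : ∀ t, 0 ≤ t → |expSum h c₀ t| ≤ 1 := by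
    intro t ht
    rw [← hc₀, abs_neg, abs_of_pos (Real.exp_pos _), Real.exp_le_one_iff]
    nlinarith [hpos ⟨0, hd⟩]
  have hN₀ : N c₀ = 2 := by
    simp only [hN, ← hc₀]
    norm_num
  have hD₀ : 0 < D c₀ := by
    have h1 : HasDerivAt (fun t => -Real.exp (-h ⟨0, hd⟩ * t)) (h ⟨0, hd⟩) 0 := by
      simpa using (((hasDerivAt_id (0 : ℝ)).const_mul (-h ⟨0, hd⟩)).exp).fun_neg
    simp only [hD, ← hc₀, h1.deriv]
    have := hpos ⟨0, hd⟩
    norm_num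
    positivity
  -- The points of the ball no worse than `c₀`. Cross-multiplication makes this a closed condition
  -- without presupposing a positive denominator, which is recovered afterwards.
  set S : Set (Fin d → ℝ) := {c | (∀ t, 0 ≤ t → |expSum h c t| ≤ 1) ∧
    N c * D c₀ ≤ N c₀ * D c} with hS
  have hclosed : IsClosed S := by
    have e : S = (⋂ t, ⋂ (_ : 0 ≤ t), {c | |expSum h c t| ≤ 1}) ∩
        {c | N c * D c₀ ≤ N c₀ * D c} := by
      ext c
      simp [hS]
    rw [e]
    exact (isClosed_iInter fun t => isClosed_iInter fun _ =>
      isClosed_le (hcont t).abs continuous_const).inter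
      (isClosed_le (hNc.mul continuous_const) (continuous_const.mul hDc))
  have hcomp : IsCompact S := by
    refine Metric.isCompact_of_isClosed_isBounded hclosed ?_
    refine (Metric.isBounded_closedBall (x := (0 : Fin d → ℝ)) (r := K * 1)).subset fun c hc => ?_
    rw [mem_closedBall_zero_iff]
    exact (pi_norm_le_iff_of_nonneg (by positivity)).2 (hK c 1 zero_le_one hc.1)
  have hDpos : ∀ c ∈ S, 0 < D c := by
    intro c hc
    have h1 : expSum h c 0 ≤ 1 := (abs_le.1 (hc.1 0 le_rfl)).2
    have h2 : 0 ≤ N c := sub_nonneg.2 h1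
    have h3 : 0 ≤ D c := by
      have := hc.2
      rw [hN₀] at this
      nlinarith [mul_nonneg h2 hD₀.le]
    -- A zero denominator forces a zero numerator, hence `p 0 = 1` and `p' 0 = ε > 0`, which is
    -- impossible.
    refine h3.lt_of_ne fun h0 => ?_
    have h4 : N c = 0 := by
      have := hc.2
      rw [← h0, mul_zero] at this
      nlinarith
    have h5 : expSum h c 0 = 1 := by simp only [hN] at h4; linarith
    have h6 : deriv (expSum h c) 0 = ε := by
      simp only [hD, h5] at h0; linarith
    refine (value_lt_one (differentiable_of_mem_expPoly (expSum_mem h c)) hc.1 ?_).ne h5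
    rw [h6]
    exact hε
  obtain ⟨c, hcS, hmin⟩ := hcomp.exists_isMinOn ⟨c₀, hball₀, by linarith⟩
    (f := fun c => N c / D c)
    (hNc.continuousOn.div hDc.continuousOn fun c hc => (hDpos c hc).ne')
  refine ⟨N c / D c, ⟨expSum h c, expSum_mem h c, halfLineNorm_le hcS.1, ?_, rfl⟩, ?_⟩
  · exact sub_pos.1 (hDpos c hcS)
  rintro _ ⟨p, hp, hp1, hp2, rfl⟩
  rw [halfLineNorm_le_iff hpos hp] at hp1
  obtain ⟨c', rfl⟩ := mem_expPoly_iff.1 hp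
  have hD' : 0 < D c' := sub_pos.2 hp2
  change N c / D c ≤ N c' / D c'
  by_cases hc' : N c' * D c₀ ≤ N c₀ * D c'
  · exact hmin ⟨hp1, hc'⟩
  · refine (hmin (a := c₀) ⟨hball₀, by linarith⟩).trans ?_
    change N c₀ / D c₀ ≤ _
    rw [div_le_div_iff₀ hD₀ hD']
    linarith

end

/-! ### The strict Taylor estimate and the lower bound for the objective. -/

section

variable {d : ℕ} {h : Fin d → ℝ} {f : ℝ → ℝ}

theorem eq_zero_of_deriv_eq_zero (hpos : ∀ i, 0 < h i) (hf : f ∈ expPoly h)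
    (h0 : deriv f = 0) : f = 0 := by
  have hconst := is_const_of_deriv_eq_zero (differentiable_of_mem_expPoly hf) (congrFun h0)
  funext t
  refine tendsto_nhds_unique (f := f) (l := atTop) ?_ (tendsto_zero_of_mem_expPoly hpos hf)
  exact tendsto_const_nhds.congr fun s => hconst t s

theorem eq_zero_of_infinite_zeros (hf : f ∈ expPoly h) {S : Set ℝ} (hS : S.Infinite)
    (h0 : ∀ t ∈ S, f t = 0) : f = 0 := by
  obtain ⟨Z, hZ, hc⟩ := hS.exists_subset_card_eq d
  exact eq_zero_of_card_zeros (expPoly_eq_expKer h ▸ hf) Z (fun z hz => h0 z (hZ hz)) hc.ge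

/-- An exponential polynomial agreeing with a quadratic polynomial on an interval vanishes. -/
theorem eq_zero_of_eq_quadratic (hpos : ∀ i, 0 < h i) (hf : f ∈ expPoly h) {x y M t : ℝ}
    (ht : 0 < t) (heq : ∀ s ∈ Ioo 0 t, f s = x + y * s - M * s ^ 2 / 2) : f = 0 := by
  have h1 := deriv_mem_expPoly hf
  have h2 := deriv_mem_expPoly h1
  have h3 := deriv_mem_expPoly h2
  -- The third derivative vanishes on a whole interval, so it is zero; decay at infinity then
  -- removes the derivatives one by one.
  refine eq_zero_of_deriv_eq_zero hpos hf (eq_zero_of_deriv_eq_zero hpos h1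
    (eq_zero_of_deriv_eq_zero hpos h2 (eq_zero_of_infinite_zeros h3 (Ioo_infinite ht) ?_)))
  intro s hs
  have e : f =ᶠ[𝓝 s] fun s => x + y * s - M * s ^ 2 / 2 :=
    Filter.eventually_of_mem (Ioo_mem_nhds hs.1 hs.2) heq
  have d1 : deriv (fun s : ℝ => x + y * s - M * s ^ 2 / 2) = fun s => y - M * s := by
    funext s
    have := (((hasDerivAt_id s).const_mul y).const_add x).fun_sub
      ((((hasDerivAt_id s).fun_pow 2).const_mul M).div_const 2)
    refine (this.congr_deriv ?_).deriv
    simp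
    ring
  have d2 : deriv (fun s : ℝ => y - M * s) = fun _ => -M := by
    funext s
    simp
  have e3 := e.deriv.deriv.deriv.eq_of_nhds
  rw [d1, d2, deriv_const] at e3
  exact e3

/-- The strict second order Taylor estimate for exponential polynomials. -/
theorem taylor_lt (hpos : ∀ i, 0 < h i) (hf : f ∈ expPoly h) (hne : f ≠ 0) {M : ℝ}
    (hM : ∀ t, 0 ≤ t → |deriv (deriv f) t| ≤ M) {t : ℝ} (ht : 0 < t) :
    f 0 + deriv f 0 * t - M * t ^ 2 / 2 < f t := by
  set G : ℝ → ℝ := fun s => f s - (f 0 + deriv f 0 * s - M * s ^ 2 / 2) with hG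
  have hd1 : ∀ s, HasDerivAt G (deriv f s - (deriv f 0 - M * s)) s := by
    intro s
    have := (((hasDerivAt_id s).const_mul (deriv f 0)).const_add (f 0)).fun_sub
      ((((hasDerivAt_id s).fun_pow 2).const_mul M).div_const 2)
    refine ((differentiable_of_mem_expPoly hf s).hasDerivAt.fun_sub this).congr_deriv ?_
    simp
    ring
  have hd2 : ∀ s, HasDerivAt (fun s => deriv f s - (deriv f 0 - M * s)) (deriv (deriv f) s + M) s := by
    intro s
    refine ((differentiable_of_mem_expPoly (deriv_mem_expPoly hf) s).hasDerivAt.fun_sub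
      (((hasDerivAt_id s).const_mul M).const_sub (deriv f 0))).congr_deriv ?_
    simp
  have hm1 : MonotoneOn (fun s => deriv f s - (deriv f 0 - M * s)) (Ici 0) := by
    refine monotoneOn_of_deriv_nonneg (convex_Ici 0)
      (fun s _ => (hd2 s).continuousAt.continuousWithinAt)
      (fun s _ => (hd2 s).differentiableAt.differentiableWithinAt) fun s hs => ?_
    rw [interior_Ici] at hs
    rw [(hd2 s).deriv]
    linarith [(abs_le.1 (hM s (le_of_lt hs))).1]
  have hm0 : MonotoneOn G (Ici 0) := by
    refine monotoneOn_of_deriv_nonneg (convex_Ici 0)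
      (fun s _ => (hd1 s).continuousAt.continuousWithinAt)
      (fun s _ => (hd1 s).differentiableAt.differentiableWithinAt) fun s hs => ?_
    rw [interior_Ici] at hs
    rw [(hd1 s).deriv]
    have hs' : (0 : ℝ) ≤ s := le_of_lt hs
    have := hm1 self_mem_Ici hs' hs'
    simpa using this
  have hG0 : G 0 = 0 := by simp [hG]
  -- Since `G` is monotone from `G 0 = 0`, failure at `t` makes `G` vanish on all of `(0, t)`.
  by_contra! hle
  have hGt : G t ≤ 0 := sub_nonpos.2 hle
  refine hne (eq_zero_of_eq_quadratic hpos hf ht (x := f 0) (y := deriv f 0) (M := M) ?_)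
  intro s hs
  have h1 := hm0 self_mem_Ici hs.1.le hs.1.le
  have h2 := hm0 hs.1.le ht.le hs.2.le
  have h3 : G s = 0 := by linarith
  exact sub_eq_zero.1 h3

theorem lt_objective (hpos : ∀ i, 0 < h i) (hf : f ∈ expPoly h) {ε : ℝ} (hε : 0 < ε)
    (hle : ∀ t, 0 ≤ t → |f t| ≤ 1) (hlt : ε * f 0 < deriv f 0) :
    2 * ε / (markovConst 2 h + 2 * ε ^ 2) < (1 - f 0) / (deriv f 0 - ε * f 0) := by
  set M := markovConst 2 h
  have hM : ∀ t, 0 ≤ t → |deriv (deriv f) t| ≤ M := by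
    intro t ht
    refine (abs_le_halfLineNorm hpos (deriv_mem_expPoly (deriv_mem_expPoly hf)) ht).trans ?_
    rw [← iteratedDeriv_two]
    exact le_csSup (bddAbove_markov hpos) ⟨f, hf, halfLineNorm_le hle, rfl⟩
  have hM0 : 0 ≤ M := (abs_nonneg _).trans (hM 0 le_rfl)
  have hx := (abs_le.1 (hle 0 le_rfl)).2
  have hε2 : 0 < ε ^ 2 := by positivity
  rw [div_lt_div_iff₀ (by positivity) (sub_pos.2 hlt)]
  rcases le_or_gt (deriv f 0) 0 with hy | hy
  · nlinarith [mul_nonneg (sub_nonneg.2 hx) hM0, mul_nonneg hε.le (neg_nonneg.2 hy)]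
  · have hne : f ≠ 0 := by
      rintro rfl
      have : deriv (0 : ℝ → ℝ) 0 = 0 := deriv_const _ _
      exact hy.ne' this
    have hMpos : 0 < M := by
      refine hM0.lt_of_ne fun h0 => ?_
      -- With `M = 0` the tangent line would climb by `2` at this point, from at least `-1` to
      -- strictly below `1`.
      have h1 := taylor_lt hpos hf hne hM (t := 2 / deriv f 0) (by positivity)
      have h2 := (abs_le.1 (hle (2 / deriv f 0) (by positivity))).2
      have h3 := (abs_le.1 (hle 0 le_rfl)).1
      rw [← h0, mul_div_cancel₀ _ hy.ne'] at h1
      linarith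
    -- The vertex of the Taylor parabola, which gives the best bound.
    have h1 := taylor_lt hpos hf hne hM (t := deriv f 0 / M) (by positivity)
    have h2 := (abs_le.1 (hle (deriv f 0 / M) (by positivity))).2
    have h3 : deriv f 0 * (deriv f 0 / M) - M * (deriv f 0 / M) ^ 2 / 2 =
        deriv f 0 ^ 2 / (2 * M) := by
      field_simp
      ring
    have h4 : deriv f 0 ^ 2 / (2 * M) < 1 - f 0 := by linarith
    rw [div_lt_iff₀ (by positivity)] at h4
    -- The two sides differ by `(M (1 - f 0) - f' 0 ^ 2 / 2) + (f' 0 - 2 ε) ^ 2 / 2`.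
    nlinarith [sq_nonneg (deriv f 0 - 2 * ε)]

end

/-! ### Alternance of a minimizer by perturbation. -/

section

theorem eventually_pos_right {g : ℝ → ℝ} {x g' : ℝ} (hg : HasDerivAt g g' x) (h0 : g x = 0)
    (hpos : 0 < g') : ∀ᶠ u in 𝓝[>] x, 0 < g u := by
  have h1 := (hasDerivAt_iff_tendsto_slope.1 hg).mono_left (nhdsGT_le_nhdsNE x)
  filter_upwards [h1.eventually (lt_mem_nhds hpos), self_mem_nhdsWithin] with u hu hxu
  rw [slope_def_field, h0, sub_zero] at hu
  exact (div_pos_iff_of_pos_right (sub_pos.2 hxu)).1 hu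

theorem eventually_neg_left {g : ℝ → ℝ} {x g' : ℝ} (hg : HasDerivAt g g' x) (h0 : g x = 0)
    (hpos : 0 < g') : ∀ᶠ u in 𝓝[<] x, g u < 0 := by
  have h1 := (hasDerivAt_iff_tendsto_slope.1 hg).mono_left (nhdsLT_le_nhdsNE x)
  filter_upwards [h1.eventually (lt_mem_nhds hpos), self_mem_nhdsWithin] with u hu hxu
  rw [slope_def_field, h0, sub_zero] at hu
  by_contra! hgu
  exact hu.not_ge (div_nonpos_of_nonneg_of_nonpos hgu (sub_neg.2 hxu).le)

theorem exists_zero_between {g : ℝ → ℝ} (hg : Continuous g) {x y u v : ℝ} (hu : u ∈ Ioo x y)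
    (hv : v ∈ Ioo x y) (hgu : 0 < g u) (hgv : g v < 0) : ∃ ξ ∈ Ioo x y, g ξ = 0 := by
  obtain ⟨ξ, hξ, h0⟩ := intermediate_value_uIcc (a := v) (b := u) hg.continuousOn
    (Icc_subset_uIcc ⟨hgv.le, hgu.le⟩ : (0 : ℝ) ∈ _)
  exact ⟨ξ, (ordConnected_Ioo.uIcc_subset hv hu) hξ, h0⟩

/-- Just after `x` the function is positive and just before `y` negative. -/
theorem exists_zero_between_increasing_zeros {g : ℝ → ℝ} (hg : Differentiable ℝ g) {x y : ℝ}
    (hxy : x < y) (hx : g x = 0) (hy : g y = 0) (hx' : 0 < deriv g x) (hy' : 0 < deriv g y) :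
    ∃ ξ ∈ Ioo x y, g ξ = 0 := by
  obtain ⟨u, hu, hgu⟩ := ((eventually_pos_right (hg x).hasDerivAt hx hx').and
    (Ioo_mem_nhdsGT hxy)).exists
  obtain ⟨v, hv, hgv⟩ := ((eventually_neg_left (hg y).hasDerivAt hy hy').and
    (Ioo_mem_nhdsLT hxy)).exists
  exact exists_zero_between hg.continuous hgu hgv hu hv

variable {k : ℕ}

/-- Dimension `k + 2` exceeds the `k + 1` linear conditions. -/
theorem exists_ne_zero_of_zeros (h : Fin (k + 2) → ℝ) (z : ℕ → ℝ) :
    ∃ q ∈ expPoly h, q ≠ 0 ∧ ∀ j ≤ k, q (z j) = 0 := by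
  let E : (ℝ → ℝ) →ₗ[ℝ] (Fin (k + 1) → ℝ) :=
    { toFun := fun f i => f (z i)
      map_add' := fun _ _ => rfl
      map_smul' := fun _ _ => rfl }
  have hker : LinearMap.ker (E.comp (Fintype.linearCombination ℝ (expFun h))) ≠ ⊥ :=
    LinearMap.ker_ne_bot_of_finrank_lt (by simp)
  obtain ⟨c, hc, hc0⟩ := (Submodule.ne_bot_iff _).1 hker
  refine ⟨Fintype.linearCombination ℝ (expFun h) c, ?_, fun h0 => hc0 ?_, fun j hj => ?_⟩
  · rw [expPoly, ← Fintype.range_linearCombination]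
    exact ⟨c, rfl⟩
  · rw [Fintype.linearCombination_apply] at h0
    exact funext (Fintype.linearIndependent_iff.1 (linearIndependent_expFun h) c h0)
  · exact congrFun (LinearMap.mem_ker.1 hc) ⟨j, by omega⟩

/-- An exponential polynomial with prescribed changes of sign. -/
theorem exists_sign_pattern (h : Fin (k + 2) → ℝ) {z : ℕ → ℝ} (hz : StrictMono z) :
    ∃ q ∈ expPoly h, q (z 0) = 0 ∧ 0 < deriv q (z 0) ∧
      ∀ j ≤ k, ∀ t, z j ≤ t → (j < k → t ≤ z (j + 1)) → 0 ≤ (-1) ^ j * q t := by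
  obtain ⟨q, hq, hne, hqz⟩ := exists_ne_zero_of_zeros h z
  set Z : Finset ℝ := (Finset.range (k + 1)).image z with hZdef
  have hZc : Z.card = k + 1 := by
    rw [hZdef, Finset.card_image_of_injective _ hz.injective, Finset.card_range]
  have hZmem : ∀ x, x ∈ Z ↔ ∃ j ≤ k, z j = x := by
    intro x
    simp [hZdef]
  have hZ0 : ∀ x ∈ Z, q x = 0 := by
    intro x hx
    obtain ⟨j, hj, rfl⟩ := (hZmem x).1 hx
    exact hqz j hj
  have hqV := expPoly_eq_expKer h ▸ hq
  -- The `k + 1` prescribed zeros exhaust the zero count: each is simple and there are no others.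
  have hsimple : ∀ j ≤ k, deriv q (z j) ≠ 0 := fun j hj h0 =>
    hne (eq_zero_of_double_zero hqV Z hZ0 (by omega) ((hZmem _).2 ⟨j, hj, rfl⟩) h0)
  have honly : ∀ x, q x = 0 → ∃ j ≤ k, z j = x := by
    intro x hx
    by_contra hxZ
    rw [← hZmem] at hxZ
    refine hne (eq_zero_of_card_zeros hqV (insert x Z) (fun y hy => ?_) ?_)
    · rcases Finset.mem_insert.1 hy with rfl | hy
      exacts [hx, hZ0 y hy]
    · rw [Finset.card_insert_of_notMem hxZ]
      omega
  clear hqV hZ0 hZmem hZc hZdef Z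
  wlog hpos : 0 < deriv q (z 0) generalizing q
  · have hd : ∀ x, deriv (-q) x = -deriv q x := fun x => deriv.neg
    refine this (-q) (Submodule.neg_mem _ hq) (neg_ne_zero.2 hne) (fun j hj => by simp [hqz j hj])
      (fun j hj => by rw [hd]; exact neg_ne_zero.2 (hsimple j hj))
      (fun x hx => honly x (by simpa using hx)) ?_
    rw [hd, neg_pos]
    exact (not_lt.1 hpos).lt_of_ne (hsimple 0 (Nat.zero_le _))
  have hqd := differentiable_of_mem_expPoly hq
  have hsd : ∀ σ : ℝ, Differentiable ℝ fun t => σ * q t := fun σ => hqd.const_mul σ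
  have hsd' : ∀ σ t : ℝ, deriv (fun t => σ * q t) t = σ * deriv q t := fun σ t =>
    deriv_const_mul _ (hqd t)
  have hpow : ∀ j : ℕ, ((-1 : ℝ)) ^ j ≠ 0 := fun j => pow_ne_zero _ (by norm_num)
  have hgap : ∀ j ≤ k, ∀ x y, z j ≤ x → (j < k → y ≤ z (j + 1)) → ∀ ξ ∈ Ioo x y, q ξ ≠ 0 := by
    intro j hj x y hx hy ξ hξ h0
    obtain ⟨i, hi, rfl⟩ := honly ξ h0
    have h1 : j < i := hz.lt_iff_lt.1 (hx.trans_lt hξ.1)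
    have h2 : i < j + 1 := hz.lt_iff_lt.1 (hξ.2.trans_le (hy (by omega)))
    omega
  -- Equal derivative signs at two consecutive zeros would create a further zero between them.
  have hsign : ∀ j ≤ k, 0 < (-1) ^ j * deriv q (z j) := by
    intro j
    induction j with
    | zero => intro _; simpa using hpos
    | succ j ih =>
      intro hj
      have h1 := ih (by omega)
      by_contra! h2
      have h3 : 0 < (-1) ^ j * deriv q (z (j + 1)) := by
        have h4 := h2.lt_of_ne (mul_ne_zero (hpow _) (hsimple _ hj))
        rw [pow_succ] at h4
        linarith
      obtain ⟨ξ, hξ, h0⟩ := exists_zero_between_increasing_zeros (hsd ((-1) ^ j))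
        (hz (Nat.lt_succ_self j)) (by simp [hqz j (by omega)]) (by simp [hqz (j + 1) hj])
        (by rw [hsd']; exact h1) (by rw [hsd']; exact h3)
      exact hgap j (by omega) _ _ le_rfl (fun _ => le_rfl) ξ hξ
        ((mul_eq_zero.1 h0).resolve_left (hpow j))
  refine ⟨q, hq, hqz 0 (Nat.zero_le _), hpos, fun j hj t htl htr => ?_⟩
  by_contra! hlt
  have htl' : z j < t := htl.lt_of_ne fun he => by
    rw [← he, hqz j hj, mul_zero] at hlt
    exact hlt.false
  obtain ⟨u, hu, hgu⟩ := ((eventually_pos_right (hsd ((-1) ^ j) (z j)).hasDerivAt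
    (by simp [hqz j hj]) (by rw [hsd']; exact hsign j hj)).and (Ioo_mem_nhdsGT htl')).exists
  obtain ⟨ξ, hξ, h0⟩ := intermediate_value_Icc' hgu.2.le (hsd ((-1) ^ j)).continuous.continuousOn
    (show (0 : ℝ) ∈ Icc ((-1) ^ j * q t) ((-1) ^ j * q u) from ⟨hlt.le, hu.le⟩)
  have hξt : ξ < t := hξ.2.lt_of_ne fun he => by
    rw [he] at h0
    exact hlt.ne h0
  exact hgap j hj _ _ le_rfl htr ξ ⟨hgu.1.trans_le hξ.1, hξt⟩
    ((mul_eq_zero.1 h0).resolve_left (hpow j))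

/-- A continuous function bounded by one on a half-line and vanishing at infinity either has `k + 1`
points of alternance, or the half-line splits into `k + 1` pieces on which the function avoids
the values `1` and `-1` alternately. -/
theorem exists_alternation_or_pieces (k : ℕ) {p : ℝ → ℝ} {b : ℝ} (hp : Continuous p)
    (h0 : Tendsto p atTop (𝓝 0)) (h1 : ∀ t, b ≤ t → |p t| ≤ 1) (hb : p b < 1) :
    (∃ s : ℕ → ℝ, b < s 0 ∧ (∀ i < k, s i < s (i + 1)) ∧ ∀ i ≤ k, p (s i) = (-1) ^ i) ∨
    ∃ z : ℕ → ℝ, StrictMono z ∧ z 0 = b ∧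
      ∀ j ≤ k, ∀ t, z j ≤ t → (j < k → t ≤ z (j + 1)) → (-1) ^ j * p t < 1 := by
  induction k generalizing p b with
  | zero =>
    by_cases hs : ∃ s, b < s ∧ p s = 1
    · obtain ⟨s, hbs, hs⟩ := hs
      exact Or.inl ⟨fun _ => s, hbs, by simp, by simpa using hs⟩
    · push Not at hs
      refine Or.inr ⟨fun j => b + j, fun i j hij => by simpa using hij, by simp, ?_⟩
      intro j hj t ht _
      obtain rfl : j = 0 := by omega
      have ht : b ≤ t := by simpa using ht
      rw [pow_zero, one_mul]
      rcases ht.eq_or_lt with rfl | hlt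
      · exact hb
      · exact (abs_le.1 (h1 t ht)).2.lt_of_ne (hs t hlt)
  | succ k ih =>
    by_cases hs : ∃ s, b ≤ s ∧ p s = 1
    · set S := {s | b ≤ s ∧ p s = 1} with hS
      have hSc : IsClosed S := isClosed_Ici.inter (isClosed_eq hp continuous_const)
      have hSb : BddBelow S := ⟨b, fun s hs => hs.1⟩
      set s₀ := sInf S
      have hs₀ : s₀ ∈ S := hSc.csInf_mem hs hSb
      have hbs : b < s₀ := hs₀.1.lt_of_ne fun he => by
        have := hs₀.2
        rw [← he] at this
        exact hb.ne this
      have hlt : ∀ t, b ≤ t → t < s₀ → p t < 1 := fun t hbt hts =>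
        (abs_le.1 (h1 t hbt)).2.lt_of_ne fun he => (csInf_le hSb ⟨hbt, he⟩).not_gt hts
      obtain ⟨δ, hδ, hδp⟩ := Metric.eventually_nhds_iff.1
        (hp.continuousAt.eventually (lt_mem_nhds (by rw [hs₀.2]; norm_num : -1 < p s₀)))
      -- The cut is placed shortly before the first point `s₀` with value `1`, where `p > -1` still
      -- holds up to `s₀`. The induction then runs on `-p` from `z₁`, and its first alternance point
      -- must lie beyond `s₀`.
      set z₁ := max ((b + s₀) / 2) (s₀ - δ / 2)
      have hz₁b : b < z₁ := lt_max_of_lt_left (by linarith)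
      have hz₁s : z₁ < s₀ := max_lt (by linarith) (by linarith)
      have hgt : ∀ t, z₁ ≤ t → t ≤ s₀ → -1 < p t := by
        intro t ht hts
        refine hδp ?_
        have := (le_max_right ((b + s₀) / 2) (s₀ - δ / 2)).trans ht
        rw [Real.dist_eq, abs_lt]
        constructor <;> linarith
      rcases ih (p := fun t => -p t) (b := z₁) hp.neg (by simpa using h0.neg)
        (fun t ht => by simpa using h1 t (hz₁b.le.trans ht))
        (by linarith [hgt z₁ le_rfl hz₁s.le]) with ⟨s, hzs, hsm, hsv⟩ | ⟨z, hzm, hz0, hzv⟩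
      · have hss : s₀ < s 0 := by
          by_contra! hle
          have h2 := hgt (s 0) hzs.le hle
          have h3 := hsv 0 (Nat.zero_le _)
          rw [pow_zero] at h3
          linarith
        refine Or.inl ⟨fun i => Nat.casesOn i s₀ s, hbs, ?_, ?_⟩
        · rintro (_ | i) hi
          exacts [hss, hsm i (by omega)]
        · rintro (_ | i) hi
          · simpa using hs₀.2
          · have h2 := hsv i (by omega)
            change p (s i) = _
            rw [pow_succ, ← h2]
            ring
      · refine Or.inr ⟨fun i => Nat.casesOn i b z, strictMono_nat_of_lt_succ ?_, rfl, ?_⟩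
        · rintro (_ | i)
          · change b < z 0
            rw [hz0]
            exact hz₁b
          · exact hzm (Nat.lt_succ_self i)
        · rintro (_ | j) hj t htl htr
          · have h2 : t ≤ z 0 := htr (Nat.succ_pos k)
            rw [pow_zero, one_mul]
            exact hlt t htl (by rw [hz0] at h2; linarith)
          · have h2 := hzv j (by omega) t htl fun hjk => htr (by omega)
            rw [pow_succ]
            linarith
    · push Not at hs
      obtain ⟨R, hR⟩ := eventually_atTop.1
        (h0.abs.eventually (gt_mem_nhds (by simp : |(0 : ℝ)| < 1)))
      -- If `1` is never attained, all later cuts go beyond `R`, where `|p| < 1` makes their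
      -- conditions automatic.
      refine Or.inr ⟨fun i => Nat.casesOn i b fun i => max b R + (i + 1),
        strictMono_nat_of_lt_succ ?_, rfl, ?_⟩
      · rintro (_ | i)
        · change b < max b R + (((0 : ℕ) : ℝ) + 1)
          have := le_max_left b R
          push_cast
          linarith
        · change max b R + ((i : ℝ) + 1) < max b R + (((i + 1 : ℕ) : ℝ) + 1)
          push_cast
          linarith
      · rintro (_ | j) hj t htl htr
        · rw [pow_zero, one_mul]
          exact (abs_le.1 (h1 t htl)).2.lt_of_ne (hs t htl)
        · have h2 : max b R + ((j : ℝ) + 1) ≤ t := htl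
          have h3 := hR t (by
            have := le_max_right b R
            have : (0 : ℝ) ≤ j := Nat.cast_nonneg j
            linarith)
          refine (le_abs_self _).trans_lt ?_
          rwa [abs_mul, abs_pow, abs_neg, abs_one, one_pow, one_mul]

/-- Compactness handles a bounded interval and decay handles the rest; strict inequality becomes
uniform, leaving room for a perturbation. -/
theorem exists_gap {g : ℝ → ℝ} (hg : Continuous g) (h0 : Tendsto g atTop (𝓝 0)) {S : Set ℝ}
    (hS : IsClosed S) (hS0 : S ⊆ Ici 0) (hlt : ∀ t ∈ S, g t < 1) :
    ∃ η > 0, ∀ t ∈ S, g t ≤ 1 - η := by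
  obtain ⟨R, hR⟩ := eventually_atTop.1
    (h0.eventually (gt_mem_nhds (by norm_num : (0 : ℝ) < 1 / 2)))
  have hc : IsCompact (Icc 0 R ∩ S) := isCompact_Icc.inter_right hS
  rcases (Icc 0 R ∩ S).eq_empty_or_nonempty with he | hne
  · refine ⟨1 / 2, by norm_num, fun t ht => ?_⟩
    rcases le_total t R with h | h
    · exact absurd ⟨⟨hS0 ht, h⟩, ht⟩ (eq_empty_iff_forall_notMem.1 he t)
    · linarith [hR t h]
  · obtain ⟨x, hx, hmax⟩ := hc.exists_isMaxOn hne hg.continuousOn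
    refine ⟨min (1 / 2) (1 - g x), lt_min (by norm_num) (sub_pos.2 (hlt x hx.2)), fun t ht => ?_⟩
    rcases le_total t R with h | h
    · have h2 : g t ≤ g x := hmax ⟨⟨hS0 ht, h⟩, ht⟩
      linarith [min_le_right (1 / 2) (1 - g x)]
    · linarith [hR t h, min_le_left (1 / 2) (1 - g x)]

/-- On a closed set where `p < 1` a small nonnegative perturbation keeps `|p| ≤ 1`. -/
theorem eventually_abs_add_le {p q : ℝ → ℝ} (hp : Continuous p) (h0 : Tendsto p atTop (𝓝 0))
    {S : Set ℝ} (hS : IsClosed S) (hS0 : S ⊆ Ici 0) (h1 : ∀ t ∈ S, |p t| ≤ 1) {σ B : ℝ}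
    (hσ : |σ| = 1) (hlt : ∀ t ∈ S, σ * p t < 1) (hq : ∀ t ∈ S, 0 ≤ σ * q t)
    (hB : ∀ t ∈ S, |q t| ≤ B) (hB0 : 0 < B) :
    ∀ᶠ δ in 𝓝[>] (0 : ℝ), ∀ t ∈ S, |p t + δ * q t| ≤ 1 := by
  obtain ⟨η, hη, hle⟩ := exists_gap (hp.const_mul σ) (by simpa using h0.const_mul σ) hS hS0 hlt
  filter_upwards [Ioo_mem_nhdsGT (div_pos hη hB0)] with δ hδ t ht
  have e : |p t + δ * q t| = |σ * p t + δ * (σ * q t)| := by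
    rw [← one_mul |p t + δ * q t|, ← hσ, ← abs_mul]
    congr 1
    ring
  have h2 : σ * q t ≤ B := by
    refine (le_abs_self _).trans ?_
    rw [abs_mul, hσ, one_mul]
    exact hB t ht
  have h3 : |σ * p t| ≤ 1 := by
    rw [abs_mul, hσ, one_mul]
    exact h1 t ht
  have h4 : δ * (σ * q t) ≤ η := by
    calc δ * (σ * q t) ≤ δ * B := mul_le_mul_of_nonneg_left h2 hδ.1.le
      _ ≤ η := ((lt_div_iff₀ hB0).1 hδ.2).le
  rw [e, abs_le]
  exact ⟨by linarith [(abs_le.1 h3).1, mul_nonneg hδ.1.le (hq t ht)], by linarith [hle t ht]⟩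

/-- A minimizer of the `kappa` problem has `d - 1` points of alternance in `(0, ∞)`. -/
theorem exists_alternation_of_minimal {h : Fin (k + 2) → ℝ} (hpos : ∀ i, 0 < h i) {ε : ℝ}
    {p : ℝ → ℝ} (hp : p ∈ expPoly h) (h1 : ∀ t, 0 ≤ t → |p t| ≤ 1)
    (hlt : ε * p 0 < deriv p 0) (hp1 : p 0 < 1)
    (hmin : ∀ v ∈ kappaValues h ε, (1 - p 0) / (deriv p 0 - ε * p 0) ≤ v) :
    ∃ s : ℕ → ℝ, 0 < s 0 ∧ (∀ i < k, s i < s (i + 1)) ∧ ∀ i ≤ k, p (s i) = (-1) ^ i := by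
  have hpd := differentiable_of_mem_expPoly hp
  have hp0 := tendsto_zero_of_mem_expPoly hpos hp
  refine (exists_alternation_or_pieces k hpd.continuous hp0 h1 hp1).resolve_right ?_
  rintro ⟨z, hz, hz0, hzv⟩
  obtain ⟨q, hq, hqz, hqd, hqs⟩ := exists_sign_pattern h hz
  rw [hz0] at hqz hqd
  have hqD := differentiable_of_mem_expPoly hq
  obtain ⟨B, hB⟩ := bddAbove_of_mem_expPoly hpos hq
  have hB' : ∀ t, 0 ≤ t → |q t| ≤ max B 1 := fun t ht =>
    (hB ⟨t, ht, rfl⟩).trans (le_max_left _ _)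
  have hz_nonneg : ∀ j, 0 ≤ z j := fun j => hz0 ▸ hz.monotone (Nat.zero_le j)
  have hev : ∀ᶠ δ in 𝓝[>] (0 : ℝ), ∀ j ∈ Finset.range (k + 1),
      ∀ t ∈ {t | z j ≤ t ∧ (j < k → t ≤ z (j + 1))}, |p t + δ * q t| ≤ 1 := by
    rw [eventually_all_finset]
    intro j hj
    have hj : j ≤ k := Nat.lt_succ_iff.1 (Finset.mem_range.1 hj)
    have hS0 : {t | z j ≤ t ∧ (j < k → t ≤ z (j + 1))} ⊆ Ici 0 := fun t ht =>
      (hz_nonneg j).trans ht.1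
    refine eventually_abs_add_le hpd.continuous hp0 ?_ hS0 (fun t ht => h1 t (hS0 ht))
      (σ := (-1) ^ j) (by simp) (fun t ht => hzv j hj t ht.1 ht.2)
      (fun t ht => hqs j hj t ht.1 ht.2) (fun t ht => hB' t (hS0 ht))
      (lt_of_lt_of_le one_pos (le_max_right _ _))
    by_cases hjk : j < k
    · simp only [hjk, true_imp_iff]
      exact isClosed_Icc
    · simp only [hjk, false_imp_iff, and_true]
      exact isClosed_Ici
  obtain ⟨δ, hδ, hδ0⟩ := (hev.and self_mem_nhdsWithin).exists
  have hδ0 : 0 < δ := hδ0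
  have hr1 : ∀ t, 0 ≤ t → |(p + δ • q) t| ≤ 1 := by
    intro t ht
    -- The last cut not exceeding `t` identifies the piece containing `t`.
    have hP : z (Nat.findGreatest (fun j => z j ≤ t) k) ≤ t :=
      Nat.findGreatest_spec (P := fun j => z j ≤ t) (Nat.zero_le k) (by rw [hz0]; exact ht)
    refine hδ _ (Finset.mem_range.2 (Nat.lt_succ_iff.2 (Nat.findGreatest_le k))) t ⟨hP, fun hj => ?_⟩
    have := Nat.findGreatest_is_greatest (P := fun j => z j ≤ t) (Nat.lt_succ_self _) hj
    exact (not_le.1 this).le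
  have hr0 : (p + δ • q) 0 = p 0 := by simp [hqz]
  have hrd : deriv (p + δ • q) 0 = deriv p 0 + δ * deriv q 0 :=
    ((hpd 0).hasDerivAt.add ((hqD 0).hasDerivAt.const_smul δ)).deriv
  have hmem : (1 - p 0) / (deriv p 0 + δ * deriv q 0 - ε * p 0) ∈ kappaValues h ε := by
    refine ⟨p + δ • q, Submodule.add_mem _ hp (Submodule.smul_mem _ _ hq), halfLineNorm_le hr1,
      ?_, by rw [hr0, hrd]⟩
    rw [hr0, hrd]
    linarith [mul_pos hδ0 hqd]
  refine (hmin _ hmem).not_gt ?_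
  refine div_lt_div_of_pos_left (sub_pos.2 hp1) (sub_pos.2 hlt) ?_
  linarith [mul_pos hδ0 hqd]

end

/-! ### Shifting the minimizer; uniqueness of the Chebyshev polynomial. -/

variable {k : ℕ}

theorem lt_of_forall_lt_succ {s : ℕ → ℝ} (hs : ∀ i < k, s i < s (i + 1)) {i j : ℕ} (hij : i < j)
    (hj : j ≤ k) : s i < s j := by
  induction j with
  | zero => omega
  | succ j ih =>
    rcases (Nat.lt_succ_iff.1 hij).eq_or_lt with rfl | hlt
    · exact hs i (by omega)
    · exact (ih hlt (by omega)).trans (hs j (by omega))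

theorem deriv_eq_zero_of_abs_eq_one {f : ℝ → ℝ} (hf : ∀ t, 0 ≤ t → |f t| ≤ 1) {x : ℝ}
    (hx : 0 < x) (hfx : |f x| = 1) : deriv f x = 0 := by
  rcases (abs_eq zero_le_one).1 hfx with h | h
  · refine IsLocalMax.deriv_eq_zero ?_
    filter_upwards [Ioi_mem_nhds hx] with t ht
    rw [h]
    exact (abs_le.1 (hf t (le_of_lt ht))).2
  · refine IsLocalMin.deriv_eq_zero ?_
    filter_upwards [Ioi_mem_nhds hx] with t ht
    rw [h]
    exact (abs_le.1 (hf t (le_of_lt ht))).1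

/-- The derivative lies in the same space, so the zero count limits critical points to `d - 1`. -/
theorem eq_zero_of_card_deriv_zeros {d : ℕ} {h : Fin d → ℝ} (hpos : ∀ i, 0 < h i) {f : ℝ → ℝ}
    (hf : f ∈ expPoly h) (Z : Finset ℝ) (hZ : ∀ z ∈ Z, deriv f z = 0) (hc : d ≤ Z.card) :
    f = 0 :=
  eq_zero_of_deriv_eq_zero hpos hf
    (eq_zero_of_card_zeros (expPoly_eq_expKer h ▸ deriv_mem_expPoly hf) Z hZ hc)

/-- An exponential polynomial bounded by one on `[0, ∞)` with `d - 1` points of alternance there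
can be continued to the left, within the same bound, until it takes the value `-1`. -/
theorem exists_shift {h : Fin (k + 2) → ℝ} (hpos : ∀ i, 0 < h i) {p : ℝ → ℝ} (hp : p ∈ expPoly h)
    (h1 : ∀ t, 0 ≤ t → |p t| ≤ 1) {s : ℕ → ℝ} (hs0 : 0 < s 0)
    (hs : ∀ i < k, s i < s (i + 1)) (hsv : ∀ i ≤ k, p (s i) = (-1) ^ i) (hp1 : p 0 < 1) :
    ∃ τ, 0 ≤ τ ∧ p (-τ) = -1 ∧ ∀ t, -τ ≤ t → |p t| ≤ 1 := by
  have hpd := differentiable_of_mem_expPoly hp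
  have hs00 : p (s 0) = 1 := by simpa using hsv 0 (Nat.zero_le k)
  have hne : p ≠ 0 := by
    rintro rfl
    simp at hs00
  have hsle : ∀ i ≤ k, s 0 ≤ s i := fun i hi => by
    rcases Nat.eq_zero_or_pos i with rfl | hi0
    · exact le_rfl
    · exact (lt_of_forall_lt_succ hs hi0 hi).le
  -- The alternance points are already `k + 1` critical points, the maximum possible. By Rolle, `p`
  -- is thus injective on `(-∞, s 0]`.
  have hcrit : ∀ x < s 0, deriv p x ≠ 0 := by
    intro x hx hx0
    set Z := (Finset.range (k + 1)).image s with hZ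
    have hZc : Z.card = k + 1 := by
      rw [hZ, Finset.card_image_of_injOn, Finset.card_range]
      intro i hi j hj hij
      have hi := Nat.lt_succ_iff.1 (Finset.mem_range.1 hi)
      have hj := Nat.lt_succ_iff.1 (Finset.mem_range.1 hj)
      rcases lt_trichotomy i j with hlt | he | hlt
      · exact absurd hij (lt_of_forall_lt_succ hs hlt hj).ne
      · exact he
      · exact absurd hij (lt_of_forall_lt_succ hs hlt hi).ne'
    have hxZ : x ∉ Z := fun hxZ => by
      obtain ⟨i, hi, rfl⟩ := Finset.mem_image.1 hxZ
      exact (hsle i (Nat.lt_succ_iff.1 (Finset.mem_range.1 hi))).not_gt hx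
    refine hne (eq_zero_of_card_deriv_zeros hpos hp (insert x Z) (fun y hy => ?_) ?_)
    · rcases Finset.mem_insert.1 hy with rfl | hy
      · exact hx0
      · obtain ⟨i, hi, rfl⟩ := Finset.mem_image.1 hy
        have hi := Nat.lt_succ_iff.1 (Finset.mem_range.1 hi)
        exact deriv_eq_zero_of_abs_eq_one h1 (hs0.trans_le (hsle i hi)) (by simp [hsv i hi])
    · rw [Finset.card_insert_of_notMem hxZ, hZc]
  have hinj : ∀ x y, x < y → y ≤ s 0 → p x ≠ p y := by
    intro x y hxy hy he
    obtain ⟨ξ, hξ, h0⟩ := exists_deriv_eq_zero hxy hpd.continuous.continuousOn he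
    exact hcrit ξ (hξ.2.trans_le hy) h0
  have hlt : ∀ x ≤ 0, p x < 1 := by
    intro x hx
    by_contra! hge
    obtain ⟨y, hy, hy1⟩ := intermediate_value_Icc' hx hpd.continuous.continuousOn
      (show (1 : ℝ) ∈ Icc (p 0) (p x) from ⟨hp1.le, hge⟩)
    exact hinj y (s 0) (hy.2.trans_lt hs0) le_rfl (by rw [hy1, hs00])
  -- Otherwise `p` would be bounded by one on the whole line and vanish.
  obtain ⟨x, hx, hx1⟩ : ∃ x ≤ 0, p x ≤ -1 := by
    by_contra! hgt
    refine hne (eq_zero_of_bounded hpos hp fun t => ?_)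
    rcases le_total t 0 with ht | ht
    · exact abs_le.2 ⟨(hgt t ht).le, (hlt t ht).le⟩
    · exact h1 t ht
  have hp0 := (abs_le.1 (h1 0 le_rfl)).1
  obtain ⟨y, hy, hy1⟩ := intermediate_value_Icc hx hpd.continuous.continuousOn
    (show (-1 : ℝ) ∈ Icc (p x) (p 0) from ⟨hx1, hp0⟩)
  refine ⟨-y, neg_nonneg.2 hy.2, by rwa [neg_neg], fun t ht => ?_⟩
  rw [neg_neg] at ht
  rcases le_total 0 t with ht0 | ht0
  · exact h1 t ht0
  refine abs_le.2 ⟨?_, (hlt t ht0).le⟩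
  by_contra! hlt'
  obtain ⟨u, hu, hu1⟩ := intermediate_value_Icc ht0 hpd.continuous.continuousOn
    (show (-1 : ℝ) ∈ Icc (p t) (p 0) from ⟨hlt'.le, hp0⟩)
  have hyt : y < t := ht.lt_of_ne fun he => by
    rw [← he, hy1] at hlt'
    exact hlt'.false
  exact hinj y u (hyt.trans_le hu.1) (hu.2.trans hs0.le) (by rw [hy1, hu1])

namespace IsExpChebyshev

variable {h : Fin (k + 2) → ℝ} {T S : ℝ → ℝ} {ν μ : Fin (k + 2) → ℝ}

theorem nonneg (hT : IsExpChebyshev h T ν) (i : Fin (k + 2)) : 0 ≤ ν i := by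
  rw [← hT.first 0 rfl]
  exact hT.strictMono.monotone (Fin.zero_le i)

theorem pos (hT : IsExpChebyshev h T ν) {i : Fin (k + 2)} (hi : i ≠ 0) : 0 < ν i := by
  rw [← hT.first 0 rfl]
  exact hT.strictMono (Fin.pos_iff_ne_zero.2 hi)

theorem abs_le_one (hpos : ∀ i, 0 < h i) (hT : IsExpChebyshev h T ν) {t : ℝ} (ht : 0 ≤ t) :
    |T t| ≤ 1 :=
  hT.norm_eq ▸ abs_le_halfLineNorm hpos hT.mem ht

theorem ne_zero (hT : IsExpChebyshev h T ν) : T ≠ 0 := by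
  rintro rfl
  have := hT.alternance 0
  simp at this

theorem deriv_eq_zero (hpos : ∀ i, 0 < h i) (hT : IsExpChebyshev h T ν) {i : Fin (k + 2)}
    (hi : i ≠ 0) : deriv T (ν i) = 0 :=
  deriv_eq_zero_of_abs_eq_one (fun _ => hT.abs_le_one hpos) (hT.pos hi) (by simp [hT.alternance])

/-- At its alternance points `T` is extremal while `|S| ≤ 1`, so `T - S` weakly inherits the sign of
`T`. -/
theorem mul_sub_nonneg (hpos : ∀ i, 0 < h i) (hT : IsExpChebyshev h T ν)
    (hS : IsExpChebyshev h S μ) (i : Fin (k + 2)) :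
    0 ≤ (-1) * (-1) ^ (i : ℕ) * (T - S) (ν i) := by
  have h1 := hS.abs_le_one hpos (hT.nonneg i)
  have h2 := hT.alternance i
  rw [pow_succ] at h2
  rw [Pi.sub_apply, h2]
  rcases neg_one_pow_eq_or ℝ (i : ℕ) with h | h <;> rw [h] <;>
    linarith [(abs_le.1 h1).1, (abs_le.1 h1).2]

/-- The points `ν` give `k + 1` weak alternations of `T - S`, one short of the needed count. The
last point of `μ` supplies another if it lies further right; if the last points coincide, `T - S`
has a double zero there. -/
theorem eq (hpos : ∀ i, 0 < h i) (hT : IsExpChebyshev h T ν) (hS : IsExpChebyshev h S μ) :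
    T = S := by
  wlog hle : ν (Fin.last _) ≤ μ (Fin.last _) generalizing T S ν μ
  · exact (this hS hT (not_le.1 hle).le).symm
  have hmem : T - S ∈ expKer (expSeq h) (k + 2) :=
    expPoly_eq_expKer h ▸ Submodule.sub_mem _ hT.mem hS.mem
  set t : ℕ → ℝ := fun i => if hi : i < k + 2 then ν ⟨i, hi⟩ else μ (Fin.last _) with ht
  have htν : ∀ i (hi : i < k + 2), t i = ν ⟨i, hi⟩ := fun i hi => by simp [ht, hi]
  have hlt : ∀ i < k + 1, t i < t (i + 1) := by
    intro i hi
    rw [htν i (by omega), htν (i + 1) (by omega)]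
    exact hT.strictMono (Nat.lt_succ_self i)
  have hsg : ∀ i ≤ k + 1, 0 ≤ (-1) * (-1) ^ i * (T - S) (t i) := by
    intro i hi
    rw [htν i (by omega)]
    exact hT.mul_sub_nonneg hpos hS ⟨i, by omega⟩
  have hlast : t (k + 1) = ν (Fin.last _) := htν _ (by omega)
  have hμ : t (k + 2) = μ (Fin.last _) := by simp [ht]
  refine sub_eq_zero.1 ?_
  rcases hle.eq_or_lt with he | hlt'
  · refine eq_zero_of_alternation_of_double_zero hmem (by norm_num : (-1 : ℝ) ≠ 0) hlt hsg ?_ ?_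
    · rw [hlast, Pi.sub_apply, hT.alternance, he, hS.alternance, sub_self]
    · have h0 : Fin.last (k + 1) ≠ 0 := (Fin.last_pos).ne'
      rw [hlast, deriv_sub (differentiable_of_mem_expPoly hT.mem _)
        (differentiable_of_mem_expPoly hS.mem _), hT.deriv_eq_zero hpos h0, he,
        hS.deriv_eq_zero hpos h0, sub_self]
  · refine eq_zero_of_alternation hmem (t := t) (by norm_num : (-1 : ℝ) ≠ 0) (fun i hi => ?_)
      fun i hi => ?_
    · rcases (Nat.lt_succ_iff.1 hi).lt_or_eq with h | rfl
      · exact hlt i h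
      · rw [hlast, hμ]
        exact hlt'
    · rcases hi.lt_or_eq with h | rfl
      · exact hsg i (by omega)
      · have h2 := hS.mul_sub_nonneg hpos hT (Fin.last _)
        rw [hμ, pow_succ]
        rw [Fin.val_last, Pi.sub_apply] at h2
        rw [Pi.sub_apply]
        linarith

/-- The nonzero `μ j` are `k + 1` critical points of `T`; a `ν i` outside them would be one too
many. -/
theorem range_subset (hpos : ∀ i, 0 < h i) (hT : IsExpChebyshev h T ν)
    (hS : IsExpChebyshev h T μ) : range ν ⊆ range μ := by
  rintro _ ⟨i, rfl⟩
  rcases eq_or_ne i 0 with rfl | hi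
  · exact ⟨0, by rw [hT.first 0 rfl, hS.first 0 rfl]⟩
  by_contra hni
  set Z := Finset.univ.image fun j : Fin (k + 1) => μ j.succ with hZ
  have hiZ : ν i ∉ Z := fun hz => by
    obtain ⟨j, -, hj⟩ := Finset.mem_image.1 hz
    exact hni ⟨_, hj⟩
  refine hT.ne_zero (eq_zero_of_card_deriv_zeros hpos hT.mem (insert (ν i) Z) (fun y hy => ?_) ?_)
  · rcases Finset.mem_insert.1 hy with rfl | hy
    · exact hT.deriv_eq_zero hpos hi
    · obtain ⟨j, -, rfl⟩ := Finset.mem_image.1 hy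
      exact hS.deriv_eq_zero hpos (Fin.succ_ne_zero j)
  · rw [Finset.card_insert_of_notMem hiZ, hZ, Finset.card_image_of_injective _
      fun _ _ hij => Fin.succ_injective _ (hS.strictMono.injective hij), Finset.card_univ, Fintype.card_fin]

/-- The Chebyshev polynomial and its points of alternance are unique. -/
theorem unique (hpos : ∀ i, 0 < h i) (hT : IsExpChebyshev h T ν) (hS : IsExpChebyshev h S μ) :
    T = S ∧ ν = μ := by
  obtain rfl := hT.eq hpos hS
  exact ⟨rfl, (hT.strictMono.range_inj hS.strictMono).1
    ((hT.range_subset hpos hS).antisymm (hS.range_subset hpos hT))⟩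

/-- A translate of `T` by `t ≥ 0` is feasible and has value `T t` and derivative `T' t` at the
origin. -/
theorem univariateValues_subset (hpos : ∀ i, 0 < h i) (hT : IsExpChebyshev h T ν) (b ε : ℝ) :
    univariateValues T b ε ⊆ kappaValues h ε := by
  rintro _ ⟨t, ht, hlt, rfl⟩
  refine ⟨fun s => T (s + t), comp_add_mem_expPoly hT.mem t,
    halfLineNorm_le fun s hs => hT.abs_le_one hpos (add_nonneg hs ht.1), ?_, ?_⟩
  · simpa only [deriv_comp_add_const, zero_add] using hlt
  · simp only [deriv_comp_add_const, zero_add]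

end IsExpChebyshev

/-- The solution of the `kappa` problem is a shift of a Chebyshev polynomial. -/
theorem exists_isExpChebyshev {h : Fin (k + 2) → ℝ} (hpos : ∀ i, 0 < h i) {ε : ℝ} (hε : 0 < ε) :
    ∃ T ν, IsExpChebyshev h T ν ∧ kappa h ε ∈ univariateValues T (ν 1) ε := by
  obtain ⟨⟨p, hp, hp1, hlt, hval⟩, hmin⟩ := isLeast_kappa (h := h) (by omega) hpos hε
  rw [halfLineNorm_le_iff hpos hp] at hp1
  have hpd := differentiable_of_mem_expPoly hp
  have hp0 : p 0 < 1 := by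
    by_contra! hge
    exact (value_lt_one hpd hp1 ((mul_pos hε (one_pos.trans_le hge)).trans hlt)).not_ge hge
  obtain ⟨s, hs0, hs, hsv⟩ := exists_alternation_of_minimal hpos hp hp1 hlt hp0
    fun v hv => hval ▸ hmin hv
  obtain ⟨τ, hτ, hpτ, hpb⟩ := exists_shift hpos hp hp1 hs0 hs hsv hp0
  have hmem := comp_add_mem_expPoly hp (-τ)
  have hbound : ∀ t, 0 ≤ t → |p (t + -τ)| ≤ 1 := fun t ht => hpb _ (by linarith)
  -- The origin of `p` moves to `τ`, which lies in `[0, ν 1]` because `ν 1 = s 0 + τ`.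
  refine ⟨fun t => p (t + -τ), Fin.cases 0 fun i : Fin (k + 1) => s i + τ,
    ⟨hmem, ?_, ?_, ?_, ?_⟩, τ, ⟨hτ, ?_⟩, ?_, ?_⟩
  · refine (halfLineNorm_le hbound).antisymm ?_
    refine le_trans ?_ (abs_le_halfLineNorm hpos hmem le_rfl)
    simp [hpτ]
  · rw [Fin.strictMono_iff_lt_succ]
    intro i
    refine Fin.cases ?_ (fun i => ?_) i
    · simp only [Fin.castSucc_zero, Fin.cases_zero, Fin.cases_succ, Fin.val_zero]
      positivity
    · rw [Fin.castSucc_succ, Fin.cases_succ, Fin.cases_succ]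
      simpa using hs i i.2
  · intro i hi
    obtain rfl : i = 0 := Fin.ext hi
    rfl
  · intro i
    refine Fin.cases ?_ (fun i => ?_) i
    · simpa using hpτ
    · have := hsv i (by omega)
      simp [this, pow_succ]
  · have : τ ≤ s 0 + τ := by linarith
    rw [← Fin.succ_zero_eq_one]
    exact this
  · simpa only [deriv_comp_add_const, add_neg_cancel] using hlt
  · simpa only [deriv_comp_add_const, add_neg_cancel] using hval

theorem proposition3 (d : ℕ) (hd : 1 ≤ d) (h : Fin d → ℝ) (hh : h ∈ expSimplex d)
    (ε : ℝ) (hε : 0 < ε) :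
    (∀ h2 : 2 ≤ d,
      (∃! Tν : (ℝ → ℝ) × (Fin d → ℝ), IsExpChebyshev h Tν.1 Tν.2) ∧
      ∀ (T : ℝ → ℝ) (ν : Fin d → ℝ), IsExpChebyshev h T ν →
        IsLeast (univariateValues T (ν ⟨1, h2⟩) ε) (kappa h ε)) ∧
    IsLeast (kappaValues h ε) (kappa h ε) ∧
    2 * ε / (markovConst 2 h + 2 * ε ^ 2) < kappa h ε := by
  have hpos := hh.1
  have hleast := isLeast_kappa hd hpos hε
  refine ⟨fun h2 => ?_, hleast, ?_⟩
  · obtain ⟨k, rfl⟩ := Nat.exists_eq_add_of_le' h2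
    obtain ⟨T, ν, hT, hκ⟩ := exists_isExpChebyshev hpos hε
    refine ⟨⟨(T, ν), hT, ?_⟩, ?_⟩
    · rintro ⟨S, μ⟩ hS
      obtain ⟨rfl, rfl⟩ := hT.unique hpos hS
      rfl
    · intro S μ hS
      obtain ⟨rfl, rfl⟩ := hT.unique hpos hS
      exact ⟨hκ, fun v hv => hleast.2 (hT.univariateValues_subset hpos _ _ hv)⟩
  · obtain ⟨p, hp, hp1, hlt, hval⟩ := hleast.1
    rw [hval]
    exact lt_objective hpos hp hε ((halfLineNorm_le_iff hpos hp).1 hp1) hlt
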